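/- Let $\rho>0$ and let $w\sim\mathcal N(0,\rho^2)$ be a centred Gaussian random variable with variance $\rho^2$. For $t\in\mathbb N$ let $m_t:=\mathbb E[w^t]$, and for $T\ge 1$ let $B_T:=(m_{i+j})_{0\le i,j\le T}$ be the $(T+1)\times(T+1)$ Hankel matrix of moments, with eigenvalues (counted with multiplicity) $$(\lambda_{\min}(B_T)=)\ \lambda_T(B_T)\le\lambda_{T-1}(B_T)\le\cdots\le\lambda_0(B_T)\ (=\lambda_{\max}(B_T)).$$ Write $x_T\simeq y_T$ if $x_T/y_T\to 1$ as $T\to\infty$. Then the largest eigenvalue dominates the spectrum of $B_T$, i.e. $$\frac{\lambda_{\max}(B_T)}{\sum_{i=0}^T\lambda_i(B_T)}\xrightarrow[T\to\infty]{}1,$$ and moreover $$\lambda_{\max}(B_T)\simeq\sqrt2\left(\frac{2\rho^2T}{e}\right)^T,\qquad \lambda_{\min}(B_T)\simeq\frac{2^{5/2}\,\pi\,T^{1/4}}{\rho^{3/2}}\exp\left(\frac1{2\rho^2}-\frac{2\sqrt T}{\rho}\right)\qquad\text{as }T\to\infty.$$ -/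

import Mathlib

open MeasureTheory ProbabilityTheory

/-- The square Hankel matrix of moments `B_T = (m_{i+j})_{0 ≤ i, j ≤ T}` of a real random
variable `w`, where `m_t = 𝔼[w ^ t]`. -/
noncomputable def momentMatrix {Ω : Type*} [MeasurableSpace Ω] (P : Measure Ω) (w : Ω → ℝ)
    (T : ℕ) : Matrix (Fin (T + 1)) (Fin (T + 1)) ℝ :=
  Matrix.of fun i j => ∫ ω, w ω ^ ((i : ℕ) + (j : ℕ)) ∂P

theorem momentMatrix_isHermitian {Ω : Type*} [MeasurableSpace Ω] (P : Measure Ω) (w : Ω → ℝ)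
    (T : ℕ) : (momentMatrix P w T).IsHermitian := by
  ext i j
  simp [momentMatrix, add_comm]

/-- The eigenvalues `λ_0(B_T) ≥ λ_1(B_T) ≥ ⋯ ≥ λ_T(B_T)` of the moment matrix, counted with
multiplicity and listed in decreasing order (Mathlib's `eigenvalues₀` is indexed by
`Fin (Fintype.card (Fin (T + 1)))`, which is only recast to `Fin (T + 1)` here). -/
noncomputable def momentEigenvalue {Ω : Type*} [MeasurableSpace Ω] (P : Measure Ω) (w : Ω → ℝ)
    (T : ℕ) (i : Fin (T + 1)) : ℝ :=
  (momentMatrix_isHermitian P w T).eigenvalues₀ (Fin.cast (Fintype.card_fin (T + 1)).symm i)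

theorem momentEigenvalue_antitone {Ω : Type*} [MeasurableSpace Ω] (P : Measure Ω) (w : Ω → ℝ)
    (T : ℕ) : Antitone (momentEigenvalue P w T) := by
  intro i j hij
  exact (momentMatrix_isHermitian P w T).eigenvalues₀_antitone (by simpa using hij)

/-- The largest eigenvalue `λ_max(B_T) = λ_0(B_T)`. -/
noncomputable def momentEigenvalueMax {Ω : Type*} [MeasurableSpace Ω] (P : Measure Ω)
    (w : Ω → ℝ) (T : ℕ) : ℝ :=
  momentEigenvalue P w T 0

/-- The smallest eigenvalue `λ_min(B_T) = λ_T(B_T)`. -/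
noncomputable def momentEigenvalueMin {Ω : Type*} [MeasurableSpace Ω] (P : Measure Ω)
    (w : Ω → ℝ) (T : ℕ) : ℝ :=
  momentEigenvalue P w T (Fin.last T)

/-- Asymptotic equivalence `x_T ≃ y_T` as `T → ∞`: the ratio `x_T / y_T` converges to `1`. -/
def AsympEquiv (x y : ℕ → ℝ) : Prop :=
  Filter.Tendsto (fun T => x T / y T) Filter.atTop (nhds 1)

/-! Largest eigenvalue. All eigenvalues are positive, so `λ_max` lies between the last diagonal
entry `m_{2T}` and the trace. Consecutive even moments have ratio `ρ² (2n + 1) → ∞`, so the trace is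
equivalent to `m_{2T}` (`tendsto_sum_evenMoment_div`). This gives the domination, and Stirling's
formula gives the value.

Smallest eigenvalue. Let `C` be the triangular matrix of coefficients of the orthonormal (Hermite)
polynomials. Orthonormality reads `C B Cᵀ = 1`, so `1 / λ_min` is the squared operator norm of `C`.
With `k = 2m + j` and `x = √k / ρ`, the entries satisfy `c_{kj}² ≈ √(2 / (π k)) · exp (-j² / (2k)) ·
(x ^ j / j!)²` for `j` of order `√k`. The weights `(x ^ j / j!)²` concentrate near `j = x`, where
the exponential is `exp (-1 / (2ρ²))`, and their sum is the Bessel value `I₀(2x) ~ exp (2x) / (2 √(π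
x))`.

Entries with `k + j` odd vanish, so `C` splits into two parity blocks, each asymptotically of rank
one. Upper bound on the norm: the square of each block is at most its trace. A telescoping
inequality (`hermiteWeight_mul_le_sub`) sums each column, and Chebyshev's inequality for the Bessel
weights does the rest. Lower bound: `C` is applied to its own last row, cut at `j ≤ J` slightly
beyond `x` (`momentEigenvalueMin_mul_le_one`). Along rows `T - 2i` the products decay at most
geometrically, and summing the squares recovers the same trace. Each parity carries half of `I₀(2x)`
up to a bounded error, because the alternating sum is `J₀(2x)`, which is at most 1 in absolute
value. -/

/-! ### Hermite polynomials and Gaussian orthogonality -/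

section StandardMoments

open Polynomial

/-- The moments of the standard Gaussian distribution. -/
noncomputable def stdMoment : ℕ → ℝ
  | 0 => 1
  | 1 => 0
  | n + 2 => (n + 1) * stdMoment n

/-- Expectation of a polynomial under the standard Gaussian distribution. -/
noncomputable def stdExpect : ℝ[X] →ₗ[ℝ] ℝ :=
  Polynomial.lsum fun n => stdMoment n • LinearMap.id

theorem stdExpect_monomial (n : ℕ) (r : ℝ) : stdExpect (monomial n r) = r * stdMoment n := by
  simp [stdExpect, Polynomial.lsum_apply, mul_comm]

/-- Gaussian integration by parts; on monomials it is the moment recursion. -/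
theorem stdExpect_X_mul (p : ℝ[X]) : stdExpect (X * p) = stdExpect (derivative p) := by
  induction p using Polynomial.induction_on' with
  | add p q hp hq => simp [mul_add, hp, hq]
  | monomial n r =>
    rw [X_mul_monomial, stdExpect_monomial, derivative_monomial, stdExpect_monomial]
    cases n with
    | zero => simp [stdMoment]
    | succ n => simp [stdMoment]; ring

/-- Hermite polynomials with real coefficients. -/
noncomputable def hermiteReal (n : ℕ) : ℝ[X] := (hermite n).map (Int.castRingHom ℝ)

theorem hermiteReal_succ (n : ℕ) :
    hermiteReal (n + 1) = X * hermiteReal n - derivative (hermiteReal n) := by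
  simp [hermiteReal, hermite_succ, derivative_map]

theorem hermiteReal_zero : hermiteReal 0 = 1 := by
  simp [hermiteReal]

theorem natDegree_hermiteReal (n : ℕ) : (hermiteReal n).natDegree = n := by
  rw [hermiteReal, (hermite_monic n).natDegree_map, natDegree_hermite]

theorem hermiteReal_monic (n : ℕ) : (hermiteReal n).Monic := (hermite_monic n).map _

/-- In `H (n + 1) = X * H n - (H n)'`, integration by parts cancels `(H n)'` and leaves one
derivative on `q`. -/
theorem stdExpect_hermiteReal_mul (n : ℕ) (q : ℝ[X]) :
    stdExpect (hermiteReal n * q) = stdExpect (derivative^[n] q) := by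
  induction n generalizing q with
  | zero => simp [hermiteReal_zero]
  | succ n ih =>
    rw [hermiteReal_succ, sub_mul, mul_assoc, map_sub, stdExpect_X_mul, derivative_mul, map_add,
      add_sub_cancel_left, ih, Function.iterate_succ_apply]

theorem stdExpect_hermiteReal_mul_hermiteReal (k l : ℕ) :
    stdExpect (hermiteReal k * hermiteReal l) = if k = l then (k.factorial : ℝ) else 0 := by
  wlog h : l ≤ k generalizing k l
  · rw [mul_comm, this l k (le_of_not_ge h)]
    by_cases e : k = l
    · simp [e]
    · simp [e, Ne.symm e]
  rw [stdExpect_hermiteReal_mul]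
  rcases h.lt_or_eq with h | h
  · rw [iterate_derivative_eq_zero (by rwa [natDegree_hermiteReal]), if_neg h.ne', map_zero]
  · subst h
    have h1 : derivative^[l] (hermiteReal l) = C (l.factorial : ℝ) := by
      have := natDegree_iterate_derivative (hermiteReal l) l
      rw [natDegree_hermiteReal, Nat.sub_self] at this
      rw [eq_C_of_natDegree_le_zero this, coeff_iterate_derivative]
      have h2 : (hermiteReal l).coeff l = 1 := by
        have := (hermiteReal_monic l).coeff_natDegree
        rwa [natDegree_hermiteReal] at this
      simp [h2, Nat.descFactorial_self]
    rw [h1, if_pos rfl, ← monomial_zero_left, stdExpect_monomial]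
    simp [stdMoment]

theorem stdExpect_mul {N : ℕ} {p q : ℝ[X]} (hp : p.natDegree < N) (hq : q.natDegree < N) :
    stdExpect (p * q) =
      ∑ i : Fin N, ∑ j : Fin N, p.coeff i * q.coeff j * stdMoment (i + j) := by
  conv_lhs => rw [p.as_sum_range' N hp, q.as_sum_range' N hq]
  rw [Finset.sum_mul_sum, map_sum, Finset.sum_range]
  refine Finset.sum_congr rfl fun i _ => ?_
  rw [map_sum, Finset.sum_range]
  refine Finset.sum_congr rfl fun j _ => ?_
  rw [monomial_mul_monomial, stdExpect_monomial]

/-- Coefficients of the orthonormal polynomials of the centred Gaussian distribution with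
standard deviation `ρ`. -/
noncomputable def orthoCoeff (ρ : ℝ) (k j : ℕ) : ℝ :=
  (hermiteReal k).coeff j / (Real.sqrt k.factorial * ρ ^ j)

theorem sum_orthoCoeff_mul {ρ : ℝ} (hρ : 0 < ρ) {N k l : ℕ} (hk : k < N) (hl : l < N) :
    ∑ i : Fin N, ∑ j : Fin N, orthoCoeff ρ k i * (ρ ^ ((i : ℕ) + j) * stdMoment (i + j)) *
      orthoCoeff ρ l j = if k = l then 1 else 0 := by
  have h := stdExpect_hermiteReal_mul_hermiteReal k l
  rw [stdExpect_mul (N := N) (by rwa [natDegree_hermiteReal])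
    (by rwa [natDegree_hermiteReal])] at h
  have h1 : ∀ n : ℕ, (0 : ℝ) < Real.sqrt n.factorial := fun n => by positivity
  calc _ = (Real.sqrt k.factorial * Real.sqrt l.factorial)⁻¹ *
        ∑ i : Fin N, ∑ j : Fin N,
          (hermiteReal k).coeff i * (hermiteReal l).coeff j * stdMoment (i + j) := by
        rw [Finset.mul_sum]
        refine Finset.sum_congr rfl fun i _ => ?_
        rw [Finset.mul_sum]
        refine Finset.sum_congr rfl fun j _ => ?_
        have := (h1 k).ne'
        have := (h1 l).ne'
        simp only [orthoCoeff]
        field_simp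
        ring
    _ = _ := by
        rw [h]
        split_ifs with e
        · subst e
          rw [Real.mul_self_sqrt (by positivity)]
          exact inv_mul_cancel₀ (by positivity)
        · simp

end StandardMoments

/-! ### Explicit coefficients of the orthonormal polynomials -/

section OrthoCoeff

open Polynomial

theorem orthoCoeff_of_odd {ρ : ℝ} {k j : ℕ} (h : Odd (k + j)) : orthoCoeff ρ k j = 0 := by
  simp [orthoCoeff, hermiteReal, coeff_hermite_of_odd_add h]

theorem orthoCoeff_of_lt {ρ : ℝ} {k j : ℕ} (h : k < j) : orthoCoeff ρ k j = 0 := by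
  simp [orthoCoeff, hermiteReal, coeff_hermite_of_lt h]

/-- The square of the coefficient of `X ^ j` in the normalised Hermite polynomial of degree
`2 * m + j` is `hermiteWeight m j / j ! ^ 2`. -/
noncomputable def hermiteWeight (m j : ℕ) : ℝ :=
  ((2 * m + j).factorial : ℝ) / ((m.factorial : ℝ) ^ 2 * 4 ^ m)

theorem hermiteWeight_pos (m j : ℕ) : 0 < hermiteWeight m j := by
  unfold hermiteWeight; positivity

theorem doubleFactorial_two_mul_sub_one (m : ℕ) :
    ((Nat.doubleFactorial (2 * m - 1) : ℕ) : ℝ) = (2 * m).factorial / (2 ^ m * m.factorial) := by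
  rw [eq_div_iff (by positivity)]
  cases m with
  | zero => simp
  | succ m =>
    have h1 := Nat.factorial_eq_mul_doubleFactorial (2 * m + 1)
    have h2 := Nat.doubleFactorial_two_mul (m + 1)
    have e1 : 2 * (m + 1) = 2 * m + 1 + 1 := by ring
    have e2 : 2 * (m + 1) - 1 = 2 * m + 1 := by omega
    rw [e2, e1, h1, ← e1, h2]
    push_cast
    ring

theorem orthoCoeff_two_mul_add (ρ : ℝ) (m j : ℕ) :
    orthoCoeff ρ (2 * m + j) j =
      (-1) ^ m * (Real.sqrt (hermiteWeight m j) / (j.factorial * ρ ^ j)) := by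
  have hc : ((2 * m + j).choose j : ℝ) =
      (2 * m + j).factorial / ((2 * m).factorial * j.factorial) := by
    rw [← Nat.add_choose_mul_factorial_mul_factorial (2 * m) j]
    push_cast
    field_simp
  have hs : Real.sqrt (hermiteWeight m j) =
      Real.sqrt ((2 * m + j).factorial) / (m.factorial * 2 ^ m) := by
    rw [hermiteWeight, Real.sqrt_div (by positivity)]
    congr 1
    rw [show ((m.factorial : ℝ) ^ 2 * 4 ^ m) = (m.factorial * 2 ^ m) ^ 2 by
      rw [mul_pow, ← pow_mul, mul_comm m 2, pow_mul]; norm_num]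
    exact Real.sqrt_sq (by positivity)
  have hf : ((2 * m + j).factorial : ℝ) =
      Real.sqrt ((2 * m + j).factorial) * Real.sqrt ((2 * m + j).factorial) :=
    (Real.mul_self_sqrt (by positivity)).symm
  have hpos : 0 < Real.sqrt ((2 * m + j).factorial) := by positivity
  rw [orthoCoeff, hermiteReal, coeff_map, coeff_hermite_explicit, hs]
  simp only [Int.cast_mul, eq_intCast, Int.cast_pow, Int.cast_neg, Int.cast_one, Int.cast_natCast]
  rw [doubleFactorial_two_mul_sub_one, hc]
  set s := Real.sqrt ((2 * m + j).factorial)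
  rw [hf]
  -- Nothing is assumed on `ρ`; if `ρ ^ j = 0`, division by zero makes both sides 0.
  by_cases hρ : ρ ^ j = 0
  · simp [hρ]
  · field_simp

theorem sq_orthoCoeff_two_mul_add (ρ : ℝ) (m j : ℕ) :
    orthoCoeff ρ (2 * m + j) j ^ 2 =
      hermiteWeight m j * (ρ⁻¹ ^ j / j.factorial) ^ 2 := by
  rw [orthoCoeff_two_mul_add, mul_pow, ← pow_mul, mul_comm m 2, pow_mul, neg_one_sq, one_pow,
    one_mul, div_pow, Real.sq_sqrt (hermiteWeight_pos m j).le, inv_pow]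
  by_cases hρ : ρ ^ j = 0
  · simp [hρ]
  · field_simp

end OrthoCoeff

/-! ### Gaussian moments and the factorisation of the moment matrix -/

section Moments

theorem integrable_pow_gaussianReal (v : NNReal) (n : ℕ) :
    Integrable (fun x : ℝ => x ^ n) (gaussianReal 0 v) := by
  have h := memLp_id_gaussianReal (μ := 0) (v := v) n
  have := h.integrable_norm_pow'
  refine (integrable_norm_iff (by fun_prop)).1 ?_
  simpa [norm_pow] using this

/-- The derivative of the density times `x ^ (n + 1)` is integrable with integral zero. -/
theorem integral_pow_add_two_gaussianReal {v : NNReal} (hv : v ≠ 0) (n : ℕ) :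
    ∫ x, x ^ (n + 2) ∂gaussianReal 0 v = (n + 1) * v * ∫ x, x ^ n ∂gaussianReal 0 v := by
  have hint : ∀ k : ℕ, Integrable (fun x : ℝ => gaussianPDFReal 0 v x * x ^ k) := by
    intro k
    have h := integrable_pow_gaussianReal v k
    rw [gaussianReal_of_var_ne_zero _ hv, integrable_withDensity_iff_integrable_smul'
      (measurable_gaussianPDF _ _) (Filter.Eventually.of_forall fun _ => gaussianPDF_lt_top)] at h
    simpa [toReal_gaussianPDF] using h
  have hv' : (v : ℝ) ≠ 0 := by exact_mod_cast hv
  have hderiv : ∀ x : ℝ, HasDerivAt (fun x => gaussianPDFReal 0 v x * x ^ (n + 1))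
      ((n + 1) * (gaussianPDFReal 0 v x * x ^ n) -
        (v : ℝ)⁻¹ * (gaussianPDFReal 0 v x * x ^ (n + 2))) x := by
    intro x
    have h1 : HasDerivAt (fun x => gaussianPDFReal 0 v x)
        (gaussianPDFReal 0 v x * (-x / v)) x := by
      unfold gaussianPDFReal
      have h2 : HasDerivAt (fun x : ℝ => -(x - 0) ^ 2 / (2 * v)) (-x / v) x := by
        have := (((hasDerivAt_id x).sub_const 0).pow 2).neg.div_const (2 * (v : ℝ))
        convert! this using 1
        simp
        field_simp
      have := h2.exp.const_mul (Real.sqrt (2 * Real.pi * v))⁻¹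
      convert! this using 1
      ring
    have := h1.mul (hasDerivAt_pow (n + 1) x)
    convert! this using 1
    push_cast
    field_simp
    ring
  have h0 := integral_eq_zero_of_hasDerivAt_of_integrable hderiv
    (((hint n).const_mul _).sub ((hint (n + 2)).const_mul _)) (hint (n + 1))
  rw [integral_sub ((hint n).const_mul _) ((hint (n + 2)).const_mul _), integral_const_mul,
    integral_const_mul] at h0
  rw [integral_gaussianReal_eq_integral_smul hv, integral_gaussianReal_eq_integral_smul hv]
  simp only [smul_eq_mul]
  field_simp at h0
  linarith

theorem integral_pow_gaussianReal {ρ : ℝ} (hρ : 0 < ρ) (n : ℕ) :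
    ∫ x, x ^ n ∂gaussianReal 0 (Real.toNNReal (ρ ^ 2)) = ρ ^ n * stdMoment n := by
  have hv : Real.toNNReal (ρ ^ 2) ≠ 0 := by
    simpa using hρ.ne'
  induction n using Nat.twoStepInduction with
  | zero => simp [stdMoment]
  | one => simp [stdMoment, integral_id_gaussianReal]
  | more n ih _ =>
    rw [integral_pow_add_two_gaussianReal hv, ih, Real.coe_toNNReal _ (by positivity), stdMoment]
    ring

theorem momentMatrix_apply_of_gaussian {Ω : Type*} [MeasurableSpace Ω] {P : Measure Ω}
    {w : Ω → ℝ} {ρ : ℝ} (hρ : 0 < ρ)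
    (hw : HasLaw w (gaussianReal 0 (Real.toNNReal (ρ ^ 2))) P) (T : ℕ) (i j : Fin (T + 1)) :
    momentMatrix P w T i j = ρ ^ ((i : ℕ) + j) * stdMoment (i + j) := by
  rw [← integral_pow_gaussianReal hρ, ← hw.map_eq, integral_map hw.aemeasurable (by fun_prop)]
  rfl

/-- The triangular matrix of coefficients of the orthonormal polynomials. -/
noncomputable def orthoMatrix (ρ : ℝ) (T : ℕ) : Matrix (Fin (T + 1)) (Fin (T + 1)) ℝ :=
  Matrix.of fun k j => orthoCoeff ρ k j

/-- With `C = orthoMatrix ρ T`, this says that the inverse of the moment matrix is `Cᵀ C`; every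
estimate of `λ_min` goes through it. -/
theorem orthoMatrix_mul_momentMatrix_mul {Ω : Type*} [MeasurableSpace Ω] {P : Measure Ω}
    {w : Ω → ℝ} {ρ : ℝ} (hρ : 0 < ρ)
    (hw : HasLaw w (gaussianReal 0 (Real.toNNReal (ρ ^ 2))) P) (T : ℕ) :
    orthoMatrix ρ T * momentMatrix P w T * (orthoMatrix ρ T).transpose = 1 := by
  ext k l
  rw [Matrix.mul_apply, Matrix.one_apply]
  simp only [Matrix.mul_apply, Finset.sum_mul]
  rw [Finset.sum_comm]
  have h := sum_orthoCoeff_mul hρ k.is_lt l.is_lt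
  simp only [momentMatrix_apply_of_gaussian hρ hw, orthoMatrix, Matrix.of_apply,
    Matrix.transpose_apply]
  rw [h]
  simp [Fin.ext_iff]

end Moments

/-! ### Quadratic forms in an eigenbasis -/

section Spectral

open Matrix

variable {n : Type*} [Fintype n] [DecidableEq n] {A : Matrix n n ℝ}

theorem Matrix.IsHermitian.dotProduct_mulVec_eigenvectorBasis (hA : A.IsHermitian) (i : n) :
    (⇑(hA.eigenvectorBasis i) : n → ℝ) ⬝ᵥ A *ᵥ ⇑(hA.eigenvectorBasis i) = hA.eigenvalues i ∧
      (⇑(hA.eigenvectorBasis i) : n → ℝ) ⬝ᵥ ⇑(hA.eigenvectorBasis i) = 1 := by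
  have h : (⇑(hA.eigenvectorBasis i) : n → ℝ) ⬝ᵥ ⇑(hA.eigenvectorBasis i) = 1 := by
    have := real_inner_self_eq_norm_sq (hA.eigenvectorBasis i)
    rw [hA.eigenvectorBasis.orthonormal.1 i, EuclideanSpace.inner_eq_star_dotProduct] at this
    simpa using this
  refine ⟨?_, h⟩
  rw [hA.mulVec_eigenvectorBasis, dotProduct_smul, h]
  simp

theorem Matrix.IsHermitian.dotProduct_mulVec_eq_sum (hA : A.IsHermitian) (v : n → ℝ) :
    v ⬝ᵥ A *ᵥ v =
      ∑ i, hA.eigenvalues i * ((⇑(hA.eigenvectorBasis i) : n → ℝ) ⬝ᵥ v) ^ 2 := by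
  have h := hA.eigenvectorBasis.sum_inner_mul_inner (WithLp.toLp 2 v) (WithLp.toLp 2 (A *ᵥ v))
  simp only [EuclideanSpace.inner_eq_star_dotProduct, star_trivial] at h
  rw [dotProduct_comm, ← h]
  refine Finset.sum_congr rfl fun i _ => ?_
  have h2 : (A *ᵥ v) ⬝ᵥ ⇑(hA.eigenvectorBasis i) =
      hA.eigenvalues i * (v ⬝ᵥ ⇑(hA.eigenvectorBasis i)) := by
    have hT : Aᵀ = A := by simpa [Matrix.IsHermitian] using hA
    rw [dotProduct_comm, dotProduct_mulVec, ← mulVec_transpose, hT, hA.mulVec_eigenvectorBasis,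
      smul_dotProduct, dotProduct_comm]
    simp
  rw [h2, dotProduct_comm v]
  ring

theorem Matrix.IsHermitian.dotProduct_self_eq_sum (hA : A.IsHermitian) (v : n → ℝ) :
    v ⬝ᵥ v = ∑ i, ((⇑(hA.eigenvectorBasis i) : n → ℝ) ⬝ᵥ v) ^ 2 := by
  have h := hA.eigenvectorBasis.sum_inner_mul_inner (WithLp.toLp 2 v) (WithLp.toLp 2 v)
  simp only [EuclideanSpace.inner_eq_star_dotProduct, star_trivial] at h
  rw [← h]
  refine Finset.sum_congr rfl fun i _ => ?_
  rw [dotProduct_comm v]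
  ring

end Spectral

/-! ### Variational bounds for the extreme eigenvalues -/

section MomentEigenvalues

open Matrix

variable {Ω : Type*} [MeasurableSpace Ω] (P : Measure Ω) (w : Ω → ℝ) (T : ℕ)

/-- Only existence is needed: `eigenvalues` reindexes the sorted `eigenvalues₀` along an equivalence
that need not preserve the order. -/
theorem exists_momentEigenvalue_eq (i : Fin (T + 1)) :
    ∃ j, (momentMatrix_isHermitian P w T).eigenvalues j = momentEigenvalue P w T i := by
  refine ⟨Fintype.equivOfCardEq (Fintype.card_fin _)
    (Fin.cast (Fintype.card_fin (T + 1)).symm i), ?_⟩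
  simp [IsHermitian.eigenvalues, momentEigenvalue]

theorem momentEigenvalueMin_le_eigenvalues (j : Fin (T + 1)) :
    momentEigenvalueMin P w T ≤ (momentMatrix_isHermitian P w T).eigenvalues j :=
  (momentMatrix_isHermitian P w T).eigenvalues₀_antitone
    (by rw [Fin.le_def]; simp only [Fin.val_cast, Fin.val_last]
        exact Nat.le_of_lt_succ (lt_of_lt_of_eq (Fin.is_lt _) (Fintype.card_fin _)))

theorem eigenvalues_le_momentEigenvalueMax (j : Fin (T + 1)) :
    (momentMatrix_isHermitian P w T).eigenvalues j ≤ momentEigenvalueMax P w T :=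
  (momentMatrix_isHermitian P w T).eigenvalues₀_antitone (by rw [Fin.le_def]; simp)

theorem sum_momentEigenvalue :
    ∑ i : Fin (T + 1), momentEigenvalue P w T i = (momentMatrix P w T).trace := by
  rw [(momentMatrix_isHermitian P w T).trace_eq_sum_eigenvalues]
  simp only [RCLike.ofReal_real_eq_id, id]
  refine ((Equiv.sum_comp (finCongr (Fintype.card_fin (T + 1)).symm)
    (momentMatrix_isHermitian P w T).eigenvalues₀).trans ?_)
  exact (Equiv.sum_comp (Fintype.equivOfCardEq (Fintype.card_fin _)).symm
    (momentMatrix_isHermitian P w T).eigenvalues₀).symm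

theorem momentEigenvalueMin_mul_le (v : Fin (T + 1) → ℝ) :
    momentEigenvalueMin P w T * (v ⬝ᵥ v) ≤ v ⬝ᵥ momentMatrix P w T *ᵥ v := by
  rw [(momentMatrix_isHermitian P w T).dotProduct_mulVec_eq_sum,
    (momentMatrix_isHermitian P w T).dotProduct_self_eq_sum, Finset.mul_sum]
  exact Finset.sum_le_sum fun i _ =>
    mul_le_mul_of_nonneg_right (momentEigenvalueMin_le_eigenvalues P w T i) (sq_nonneg _)

theorem le_momentEigenvalueMax_mul (v : Fin (T + 1) → ℝ) :
    v ⬝ᵥ momentMatrix P w T *ᵥ v ≤ momentEigenvalueMax P w T * (v ⬝ᵥ v) := by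
  rw [(momentMatrix_isHermitian P w T).dotProduct_mulVec_eq_sum,
    (momentMatrix_isHermitian P w T).dotProduct_self_eq_sum, Finset.mul_sum]
  exact Finset.sum_le_sum fun i _ =>
    mul_le_mul_of_nonneg_right (eigenvalues_le_momentEigenvalueMax P w T i) (sq_nonneg _)

theorem le_momentEigenvalueMin {c : ℝ}
    (h : ∀ v : Fin (T + 1) → ℝ, c * (v ⬝ᵥ v) ≤ v ⬝ᵥ momentMatrix P w T *ᵥ v) :
    c ≤ momentEigenvalueMin P w T := by
  obtain ⟨j, hj⟩ := exists_momentEigenvalue_eq P w T (Fin.last T)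
  have h1 := (momentMatrix_isHermitian P w T).dotProduct_mulVec_eigenvectorBasis j
  have := h ((momentMatrix_isHermitian P w T).eigenvectorBasis j)
  rw [h1.1, h1.2, hj, mul_one] at this
  exact this

theorem momentMatrix_last_le_momentEigenvalueMax :
    momentMatrix P w T (Fin.last T) (Fin.last T) ≤ momentEigenvalueMax P w T := by
  have := le_momentEigenvalueMax_mul P w T (Pi.single (Fin.last T) 1)
  simpa using this

theorem momentEigenvalueMax_le_sum (h : 0 ≤ momentEigenvalueMin P w T) :
    momentEigenvalueMax P w T ≤ ∑ i : Fin (T + 1), momentEigenvalue P w T i :=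
  Finset.single_le_sum (f := momentEigenvalue P w T)
    (fun i _ => h.trans (momentEigenvalue_antitone P w T (Fin.le_last i))) (Finset.mem_univ 0)

variable {P w} {ρ : ℝ}

theorem dotProduct_momentMatrix_mulVec (hρ : 0 < ρ)
    (hw : HasLaw w (gaussianReal 0 (Real.toNNReal (ρ ^ 2))) P) (u : Fin (T + 1) → ℝ) :
    ((orthoMatrix ρ T)ᵀ *ᵥ u) ⬝ᵥ momentMatrix P w T *ᵥ ((orthoMatrix ρ T)ᵀ *ᵥ u) = u ⬝ᵥ u := by
  have h := orthoMatrix_mul_momentMatrix_mul hρ hw T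
  rw [mulVec_mulVec, mulVec_transpose, ← dotProduct_mulVec, mulVec_mulVec, ← Matrix.mul_assoc, h,
    one_mulVec]

theorem exists_transpose_orthoMatrix_mulVec (hρ : 0 < ρ)
    (hw : HasLaw w (gaussianReal 0 (Real.toNNReal (ρ ^ 2))) P) (v : Fin (T + 1) → ℝ) :
    ∃ u, (orthoMatrix ρ T)ᵀ *ᵥ u = v := by
  have h := orthoMatrix_mul_momentMatrix_mul hρ hw T
  rw [mul_eq_one_comm] at h
  exact ⟨(orthoMatrix ρ T * momentMatrix P w T) *ᵥ v, by rw [mulVec_mulVec, h, one_mulVec]⟩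

/-- Substituting `v = Cᵀ u` turns the quadratic form of the moment matrix into `|u|²`, so a bound
`|Cᵀ u|² ≤ t |u|²` is a Rayleigh bound from below. -/
theorem inv_le_momentEigenvalueMin (hρ : 0 < ρ)
    (hw : HasLaw w (gaussianReal 0 (Real.toNNReal (ρ ^ 2))) P) {t : ℝ} (ht : 0 < t)
    (h : ∀ u : Fin (T + 1) → ℝ,
      ∑ j : Fin (T + 1), (∑ k : Fin (T + 1), orthoCoeff ρ k j * u k) ^ 2 ≤ t * ∑ k, u k ^ 2) :
    t⁻¹ ≤ momentEigenvalueMin P w T := by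
  refine le_momentEigenvalueMin P w T fun v => ?_
  obtain ⟨u, rfl⟩ := exists_transpose_orthoMatrix_mulVec T hρ hw v
  rw [dotProduct_momentMatrix_mulVec T hρ hw, inv_mul_le_iff₀ ht]
  simpa [dotProduct, mulVec, orthoMatrix, sq] using h u

theorem momentEigenvalueMin_pos (hρ : 0 < ρ)
    (hw : HasLaw w (gaussianReal 0 (Real.toNNReal (ρ ^ 2))) P) :
    0 < momentEigenvalueMin P w T := by
  set t : ℝ := ∑ j : Fin (T + 1), ∑ k : Fin (T + 1), orthoCoeff ρ k j ^ 2 with htdef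
  have ht : 0 ≤ t := by positivity
  -- The squared Frobenius norm `t` bounds `Cᵀ`; `t + 1` is positive without knowing that `t ≠ 0`.
  refine lt_of_lt_of_le (inv_pos.2 (by positivity : 0 < t + 1))
    (inv_le_momentEigenvalueMin T hρ hw (by positivity) fun u => ?_)
  calc _ ≤ ∑ j : Fin (T + 1), (∑ k : Fin (T + 1), orthoCoeff ρ k j ^ 2) * ∑ k, u k ^ 2 :=
        Finset.sum_le_sum fun j _ => Finset.sum_mul_sq_le_sq_mul_sq _ _ _
    _ = t * ∑ k, u k ^ 2 := by rw [htdef, Finset.sum_mul]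
    _ ≤ _ := by
        have : 0 ≤ ∑ k, u k ^ 2 := by positivity
        nlinarith

/-- Put `u = C y` and `z = Cᵀ u`. Then `λ_min |z|² ≤ |u|²`, while `|u|² = z · y ≤ |z| |y|` by
Cauchy–Schwarz; eliminating `z` transfers the bound from `Cᵀ` to `C`. -/
theorem momentEigenvalueMin_mul_sum_le (hρ : 0 < ρ)
    (hw : HasLaw w (gaussianReal 0 (Real.toNNReal (ρ ^ 2))) P) (y : Fin (T + 1) → ℝ) :
    momentEigenvalueMin P w T *
      ∑ k : Fin (T + 1), (∑ j : Fin (T + 1), orthoCoeff ρ k j * y j) ^ 2 ≤ ∑ j, y j ^ 2 := by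
  set C := orthoMatrix ρ T with hC
  set l := momentEigenvalueMin P w T with hl
  have hl0 : 0 < l := momentEigenvalueMin_pos T hρ hw
  set u := C *ᵥ y with hu
  set z := Cᵀ *ᵥ u with hz
  have h1 : l * (z ⬝ᵥ z) ≤ u ⬝ᵥ u := by
    have := momentEigenvalueMin_mul_le P w T z
    rwa [hz, dotProduct_momentMatrix_mulVec T hρ hw] at this
  have h2 : u ⬝ᵥ u = z ⬝ᵥ y := by
    rw [hz, mulVec_transpose, ← dotProduct_mulVec]
  have h3 : (z ⬝ᵥ y) ^ 2 ≤ (z ⬝ᵥ z) * (y ⬝ᵥ y) := by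
    have := Finset.sum_mul_sq_le_sq_mul_sq Finset.univ z y
    simpa [dotProduct, sq] using this
  have h4 : ∑ k : Fin (T + 1), (∑ j : Fin (T + 1), orthoCoeff ρ k j * y j) ^ 2 = u ⬝ᵥ u := by
    simp [hu, hC, dotProduct, mulVec, orthoMatrix, sq]
  have h5 : ∑ j, y j ^ 2 = y ⬝ᵥ y := by simp [dotProduct, sq]
  have h6 : 0 ≤ y ⬝ᵥ y := by rw [← h5]; positivity
  have h7 : 0 ≤ u ⬝ᵥ u := by rw [← h4]; positivity
  rw [h4, h5]
  rw [← h2] at h3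
  rcases h7.eq_or_lt with h0 | h0
  · rw [← h0, mul_zero]; exact h6
  · have h8 : l * (u ⬝ᵥ u) ^ 2 ≤ (u ⬝ᵥ u) * (y ⬝ᵥ y) := by nlinarith
    refine le_of_mul_le_mul_left ?_ h0
    linarith [h8]

end MomentEigenvalues

/-! ### Estimates for the weights and falling factorials -/

section Factorials

theorem hermiteWeight_succ (m j : ℕ) :
    hermiteWeight (m + 1) j * (4 * ((m : ℝ) + 1) ^ 2) =
      hermiteWeight m j * ((2 * m + j + 2) * (2 * m + j + 1)) := by
  have h : 2 * (m + 1) + j = 2 * m + j + 1 + 1 := by ring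
  rw [hermiteWeight, hermiteWeight, h, Nat.factorial_succ, Nat.factorial_succ, Nat.factorial_succ m]
  push_cast
  field_simp
  ring

/-- The weight grows like `m ^ (j - 1/2)`, so `m` times it has increments of about `j + 1/2`
weights. After multiplying by `4 (m + 1)`, the recursion leaves the difference `j² - j ≥ 0` as a
factor. Summation over `m` telescopes. -/
theorem hermiteWeight_mul_le_sub (m j : ℕ) :
    hermiteWeight m j * (j + 1 / 2) ≤
      ((m + 1 : ℕ) : ℝ) * hermiteWeight (m + 1) j - m * hermiteWeight m j := by
  have h := hermiteWeight_succ m j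
  have hp := hermiteWeight_pos m j
  have hm : (0 : ℝ) < 4 * ((m : ℝ) + 1) := by positivity
  have hj : (j : ℝ) ≤ (j : ℝ) ^ 2 := by
    exact_mod_cast Nat.le_self_pow two_ne_zero j
  refine le_of_mul_le_mul_left ?_ hm
  have e : 4 * ((m : ℝ) + 1) * (((m + 1 : ℕ) : ℝ) * hermiteWeight (m + 1) j -
      m * hermiteWeight m j) = hermiteWeight m j *
        ((2 * m + j + 2) * (2 * m + j + 1) - 4 * (m + 1) * m) := by
    push_cast
    linear_combination h
  rw [e, mul_left_comm]
  refine mul_le_mul_of_nonneg_left ?_ hp.le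
  nlinarith

theorem sum_hermiteWeight_le (M j : ℕ) :
    ∑ m ∈ Finset.range M, hermiteWeight m j ≤ M * hermiteWeight M j / (j + 1 / 2) := by
  rw [le_div_iff₀ (by positivity), Finset.sum_mul]
  refine (Finset.sum_le_sum fun m _ => hermiteWeight_mul_le_sub m j).trans ?_
  rw [Finset.sum_range_sub (fun m : ℕ => (m : ℝ) * hermiteWeight m j)]
  simp

/-- The probability that a simple random walk is at the origin after `2 * m` steps. -/
noncomputable def returnProb (m : ℕ) : ℝ := hermiteWeight m 0

/-- The link to Wallis' product, whose two-sided bounds give `returnProb m ~ 1 / √(π m)`. -/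
theorem sq_returnProb_mul (m : ℕ) :
    returnProb m ^ 2 * (Real.Wallis.W m * (2 * m + 1)) = 1 := by
  rw [returnProb, hermiteWeight, Real.Wallis.W_eq_factorial_ratio, add_zero]
  have : (2 : ℝ) ^ (4 * m) = (4 ^ m) ^ 2 := by
    rw [← pow_mul, mul_comm m 2, pow_mul 4, pow_mul 2]; norm_num
  rw [this]
  field_simp

theorem returnProb_pos (m : ℕ) : 0 < returnProb m := hermiteWeight_pos m 0

theorem mul_returnProb_le (m : ℕ) : m * returnProb m ≤ Real.sqrt (m / Real.pi) := by
  refine Real.le_sqrt_of_sq_le ?_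
  have h := sq_returnProb_mul m
  have hW := Real.Wallis.le_W m
  have hpi := Real.pi_pos
  have hr : 0 < returnProb m ^ 2 := pow_pos (returnProb_pos m) 2
  have h1 : returnProb m ^ 2 * ((2 * m + 1) ^ 2 * Real.pi) ≤ 4 * (m + 1) := by
    have h2 : ((2 * m + 1) / (2 * m + 2) * (Real.pi / 2)) * (2 * m + 1) * returnProb m ^ 2 ≤ 1 := by
      refine le_trans ?_ h.le
      rw [mul_comm (returnProb m ^ 2)]
      exact mul_le_mul_of_nonneg_right (mul_le_mul_of_nonneg_right hW
        (by positivity : (0 : ℝ) ≤ 2 * m + 1)) hr.le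
    have h3 : ((2 * (m : ℝ) + 1) / (2 * m + 2) * (Real.pi / 2)) * (2 * m + 1) * returnProb m ^ 2 =
        returnProb m ^ 2 * ((2 * m + 1) ^ 2 * Real.pi) / (4 * (m + 1)) := by
      field_simp
      ring
    rw [h3, div_le_iff₀ (by positivity)] at h2
    linarith
  rw [mul_pow, le_div_iff₀ hpi]
  have hm : (0 : ℝ) ≤ m := by positivity
  have h4 : (returnProb m ^ 2 * Real.pi) * (4 * m * (m + 1)) ≤ 4 * (m + 1) := by
    refine le_trans ?_ h1
    have : 0 < returnProb m ^ 2 * Real.pi := by positivity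
    nlinarith
  have h5 : (returnProb m ^ 2 * Real.pi) * m ≤ 1 := by
    refine le_of_mul_le_mul_right ?_ (by positivity : (0 : ℝ) < 4 * (m + 1))
    linarith
  nlinarith

theorem le_returnProb (m : ℕ) : Real.sqrt (2 / (Real.pi * (2 * m + 1))) ≤ returnProb m := by
  refine Real.sqrt_le_iff.2 ⟨(returnProb_pos m).le, ?_⟩
  have h := sq_returnProb_mul m
  have hW := Real.Wallis.W_le m
  have hpi := Real.pi_pos
  have hr : 0 < returnProb m ^ 2 := pow_pos (returnProb_pos m) 2
  rw [div_le_iff₀ (by positivity)]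
  have : returnProb m ^ 2 * (Real.Wallis.W m * (2 * m + 1)) ≤
      returnProb m ^ 2 * (Real.pi / 2 * (2 * m + 1)) := by gcongr
  linarith

theorem hermiteWeight_eq (m j : ℕ) :
    hermiteWeight m j = returnProb m * ((2 * m + j).descFactorial j : ℝ) := by
  have h := Nat.factorial_mul_descFactorial (Nat.le_add_left j (2 * m))
  rw [Nat.add_sub_cancel] at h
  rw [returnProb, hermiteWeight, hermiteWeight, ← h]
  push_cast
  simp only [add_zero]
  ring

/-- Each factor is `K (1 - i / K) ≤ K exp (-i / K)`, and the `i < j` sum to `j (j - 1) / 2`. -/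
theorem descFactorial_le_pow_mul_exp {K : ℕ} (hK : 0 < K) (j : ℕ) :
    (K.descFactorial j : ℝ) ≤ K ^ j * Real.exp (-(j * (j - 1)) / (2 * K)) := by
  have hK' : (0 : ℝ) < K := by exact_mod_cast hK
  induction j with
  | zero => simp
  | succ j ih =>
    have h1 : ((K - j : ℕ) : ℝ) ≤ K * Real.exp (-(j / K)) := by
      rcases le_total j K with h | h
      · rw [Nat.cast_sub h]
        have := Real.add_one_le_exp (-((j : ℝ) / K))
        calc (K : ℝ) - j = K * (-((j : ℝ) / K) + 1) := by field_simp; ring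
          _ ≤ _ := by gcongr
      · rw [Nat.sub_eq_zero_of_le h]; simp; positivity
    rw [Nat.descFactorial_succ]
    push_cast
    calc ((K - j : ℕ) : ℝ) * (K.descFactorial j : ℝ) ≤
        (K * Real.exp (-(j / K))) * (K ^ j * Real.exp (-(j * (j - 1)) / (2 * K))) := by gcongr
      _ = K ^ (j + 1) * (Real.exp (-(j / K)) * Real.exp (-(j * (j - 1)) / (2 * K))) := by ring
      _ = _ := by
        rw [← Real.exp_add]
        congr 2
        field_simp
        ring

theorem exp_neg_sub_sq_le {y : ℝ} (h0 : 0 ≤ y) (h1 : y ≤ 1 / 2) :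
    Real.exp (-y - y ^ 2) ≤ 1 - y := by
  have h := Real.quadratic_le_exp_of_nonneg (by positivity : 0 ≤ y + y ^ 2)
  have h2 : 1 ≤ (1 - y) * Real.exp (y + y ^ 2) := by
    have h3 : 1 ≤ (1 - y) * (1 + (y + y ^ 2) + (y + y ^ 2) ^ 2 / 2) := by
      have : (1 - y) * (1 + (y + y ^ 2) + (y + y ^ 2) ^ 2 / 2) =
        1 + y ^ 2 * (1 - y - y ^ 2 - y ^ 3) / 2 := by ring
      rw [this]
      have : 0 ≤ 1 - y - y ^ 2 - y ^ 3 := by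
        have : y ^ 2 ≤ (1 / 2) ^ 2 := by gcongr
        have : y ^ 3 ≤ (1 / 2) ^ 3 := by gcongr
        norm_num at *
        linarith
      have := mul_nonneg (sq_nonneg y) this
      linarith
    exact h3.trans (mul_le_mul_of_nonneg_left h (by linarith))
  rw [show -y - y ^ 2 = -(y + y ^ 2) by ring, Real.exp_neg]
  exact (inv_le_iff_one_le_mul₀ (Real.exp_pos _)).2 h2

/-- The converse uses `1 - y ≥ exp (-y - y²)` for `y ≤ 1/2`, hence `2 j ≤ K`. The cubic correction
vanishes in the limit when `j` is of order `√K`. -/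
theorem pow_mul_exp_le_descFactorial {K j : ℕ} (hj : 2 * j ≤ K) :
    (K : ℝ) ^ j * Real.exp (-(j : ℝ) ^ 2 / (2 * K) - (j : ℝ) ^ 3 / K ^ 2) ≤
      (K.descFactorial j : ℝ) := by
  rcases Nat.eq_zero_or_pos K with rfl | hK
  · have : j = 0 := by omega
    subst this; simp
  have hK' : (0 : ℝ) < K := by exact_mod_cast hK
  induction j with
  | zero => simp
  | succ j ih =>
    have hjK : (j : ℝ) / K ≤ 1 / 2 := by
      rw [div_le_iff₀ hK']
      have : (2 : ℝ) * j ≤ K := by exact_mod_cast (by omega : 2 * j ≤ K)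
      linarith
    have h1 : K * Real.exp (-(j / K : ℝ) - (j / K : ℝ) ^ 2) ≤ ((K - j : ℕ) : ℝ) := by
      rw [Nat.cast_sub (by omega)]
      have := exp_neg_sub_sq_le (by positivity) hjK
      calc _ ≤ (K : ℝ) * (1 - j / K) := by gcongr
        _ = _ := by field_simp
    rw [Nat.descFactorial_succ]
    push_cast
    refine le_trans ?_ (mul_le_mul h1 (ih (by omega)) (by positivity) (by positivity))
    have e : K * Real.exp (-(j / K : ℝ) - (j / K : ℝ) ^ 2) *
        (K ^ j * Real.exp (-(j : ℝ) ^ 2 / (2 * K) - (j : ℝ) ^ 3 / K ^ 2)) =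
        K ^ (j + 1) * (Real.exp ((-(j / K : ℝ) - (j / K : ℝ) ^ 2) +
          (-(j : ℝ) ^ 2 / (2 * K) - (j : ℝ) ^ 3 / K ^ 2))) := by
      rw [Real.exp_add]; ring
    rw [e]
    refine mul_le_mul_of_nonneg_left (Real.exp_le_exp.2 ?_) (by positivity)
    rw [← sub_nonneg]
    have : (-(j / K : ℝ) - (j / K : ℝ) ^ 2) + (-(j : ℝ) ^ 2 / (2 * K) - (j : ℝ) ^ 3 / K ^ 2) -
        (-((j : ℝ) + 1) ^ 2 / (2 * K) - ((j : ℝ) + 1) ^ 3 / K ^ 2) =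
        1 / (2 * K) + (2 * j ^ 2 + 3 * j + 1) / K ^ 2 := by
      field_simp
      ring
    rw [this]
    positivity

end Factorials

/-! ### Parity blocks of the inverse matrix and their traces -/

section UpperBound

/-- The summand `j` of the bound for the trace of one parity block, where `K` exceeds the degrees in
the block and has their parity. -/
noncomputable def blockTerm (ρ : ℝ) (K j : ℕ) : ℝ :=
  ((K - j) / 2 : ℕ) * hermiteWeight ((K - j) / 2) j / (j + 1 / 2) * (ρ⁻¹ ^ j / j.factorial) ^ 2

/-- The nonzero entries of column `j` sit at `k = 2m + j`. Writing `K = 2M + j`, the condition `k ≤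
T < K` forces `m < M`, and the telescoped sum applies. -/
theorem sum_sq_orthoCoeff_le_blockTerm (ρ : ℝ) {T K j : ℕ} (hT : T < K) (hj : j ≤ K)
    (hK : Even (K + j)) : ∑ k ∈ Finset.range (T + 1), orthoCoeff ρ k j ^ 2 ≤ blockTerm ρ K j := by
  obtain ⟨M, rfl⟩ : ∃ M, K = 2 * M + j := by
    obtain ⟨r, hr⟩ := hK
    exact ⟨r - j, by omega⟩
  have hM : (2 * M + j - j) / 2 = M := by omega
  rw [blockTerm, hM]
  refine le_trans ?_ (mul_le_mul_of_nonneg_right (sum_hermiteWeight_le M j) (by positivity))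
  rw [Finset.sum_mul, ← Finset.sum_filter_ne_zero]
  have hinj : Set.InjOn (fun m => 2 * m + j) (Finset.range M : Set ℕ) := by
    intro a _ b _ h
    simp only at h
    omega
  calc _ ≤ ∑ k ∈ (Finset.range M).image (fun m => 2 * m + j), orthoCoeff ρ k j ^ 2 := by
        refine Finset.sum_le_sum_of_subset_of_nonneg ?_ fun _ _ _ => sq_nonneg _
        intro k hk
        rw [Finset.mem_filter, Finset.mem_range] at hk
        have h1 : ¬ k < j := fun h => hk.2 (by rw [orthoCoeff_of_lt h]; simp)
        have h2 : Even (k + j) := by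
          by_contra h
          exact hk.2 (by rw [orthoCoeff_of_odd (Nat.not_even_iff_odd.1 h)]; simp)
        obtain ⟨r, hr⟩ := h2
        rw [Finset.mem_image]
        exact ⟨r - j, by rw [Finset.mem_range]; omega, by omega⟩
    _ = _ := by
        rw [Finset.sum_image hinj]
        exact Finset.sum_congr rfl fun m _ => sq_orthoCoeff_two_mul_add ρ m j

/-- The bound for the trace of one parity block. -/
noncomputable def blockTrace (ρ : ℝ) (K : ℕ) : ℝ :=
  ∑ j ∈ Finset.range K with Even (K + j), blockTerm ρ K j

/-- Cauchy–Schwarz for each `j` bounds the square of the block by its trace. -/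
theorem sum_sq_sum_orthoCoeff_le (ρ : ℝ) {T K : ℕ} (hT : T < K) (u : ℕ → ℝ) :
    ∑ j ∈ Finset.range (T + 1) with Even (K + j),
      (∑ k ∈ Finset.range (T + 1), orthoCoeff ρ k j * u k) ^ 2 ≤
      blockTrace ρ K * ∑ k ∈ Finset.range (T + 1) with Even (K + k), u k ^ 2 := by
  have hnn : ∀ j, 0 ≤ blockTerm ρ K j := fun j => by
    have := hermiteWeight_pos ((K - j) / 2) j
    unfold blockTerm
    positivity
  refine le_trans (b := ∑ j ∈ Finset.range (T + 1) with Even (K + j), blockTerm ρ K j *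
    ∑ k ∈ Finset.range (T + 1) with Even (K + k), u k ^ 2) ?_ ?_
  · refine Finset.sum_le_sum fun j hj => ?_
    rw [Finset.mem_filter, Finset.mem_range] at hj
    have h1 : ∑ k ∈ Finset.range (T + 1), orthoCoeff ρ k j * u k =
        ∑ k ∈ Finset.range (T + 1) with Even (K + k), orthoCoeff ρ k j * u k := by
      rw [Finset.sum_filter]
      refine Finset.sum_congr rfl fun k _ => ?_
      split_ifs with h
      · rfl
      · rw [orthoCoeff_of_odd, zero_mul]
        have := hj.2
        grind
    rw [h1]
    refine (Finset.sum_mul_sq_le_sq_mul_sq _ _ _).trans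
      (mul_le_mul_of_nonneg_right ?_ (Finset.sum_nonneg fun _ _ => sq_nonneg _))
    exact (Finset.sum_le_sum_of_subset_of_nonneg (Finset.filter_subset _ _)
      fun _ _ _ => sq_nonneg _).trans (sum_sq_orthoCoeff_le_blockTerm ρ hT (by omega) hj.2)
  · rw [← Finset.sum_mul]
    refine mul_le_mul_of_nonneg_right ?_ (Finset.sum_nonneg fun _ _ => sq_nonneg _)
    refine Finset.sum_le_sum_of_subset_of_nonneg ?_ fun _ _ _ => hnn _
    exact Finset.filter_subset_filter _ (Finset.range_mono hT)

/-- `T + 1` and `T + 2` are the least integers above `T` of the two parities, one for each block. -/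
theorem inv_le_momentEigenvalueMin_of_blockTrace_le {Ω : Type*} [MeasurableSpace Ω] {P : Measure Ω}
    {w : Ω → ℝ} {ρ : ℝ} (hρ : 0 < ρ)
    (hw : HasLaw w (gaussianReal 0 (Real.toNNReal (ρ ^ 2))) P) {T : ℕ} {t : ℝ}
    (ht : 0 < t) (h1 : blockTrace ρ (T + 1) ≤ t) (h2 : blockTrace ρ (T + 2) ≤ t) :
    t⁻¹ ≤ momentEigenvalueMin P w T := by
  refine inv_le_momentEigenvalueMin T hρ hw ht fun u => ?_
  obtain ⟨u, rfl⟩ : ∃ u' : ℕ → ℝ, (fun k : Fin (T + 1) => u' k) = u :=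
    ⟨fun k => if h : k < T + 1 then u ⟨k, h⟩ else 0, by ext k; simp only [dif_pos k.is_lt]⟩
  rw [← Finset.sum_range (fun k => u k ^ 2)]
  have hk : ∀ j : ℕ, ∑ k : Fin (T + 1), orthoCoeff ρ k j * u k =
      ∑ k ∈ Finset.range (T + 1), orthoCoeff ρ k j * u k :=
    fun j => (Finset.sum_range (fun k => orthoCoeff ρ k j * u k)).symm
  simp only [hk]
  rw [← Finset.sum_range (fun j => (∑ k ∈ Finset.range (T + 1), orthoCoeff ρ k j * u k) ^ 2)]
  have hf : ∀ f : ℕ → ℝ, ∑ j ∈ Finset.range (T + 1), f j =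
      ∑ j ∈ Finset.range (T + 1) with Even (T + 1 + j), f j +
      ∑ j ∈ Finset.range (T + 1) with Even (T + 2 + j), f j := by
    intro f
    rw [← Finset.sum_filter_add_sum_filter_not _ (fun j => Even (T + 1 + j)) f]
    congr 2
    ext j
    simp only [Finset.mem_filter, and_congr_right_iff]
    intro _
    grind
  rw [hf, hf, mul_add]
  refine add_le_add ((sum_sq_sum_orthoCoeff_le ρ (by omega) u).trans ?_)
    ((sum_sq_sum_orthoCoeff_le ρ (by omega) u).trans ?_)
  · exact mul_le_mul_of_nonneg_right h1 (Finset.sum_nonneg fun _ _ => sq_nonneg _)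
  · exact mul_le_mul_of_nonneg_right h2 (Finset.sum_nonneg fun _ _ => sq_nonneg _)

theorem blockTerm_le {ρ : ℝ} {K j : ℕ} (hK : 0 < K) (hj : j ≤ K) (hKj : Even (K + j)) :
    blockTerm ρ K j ≤ Real.sqrt (K / (2 * Real.pi)) * (Real.exp (-(j * (j - 1)) / (2 * K)) /
      (j + 1 / 2) * ((Real.sqrt K * ρ⁻¹) ^ j / j.factorial) ^ 2) := by
  obtain ⟨M, hM⟩ : ∃ M, K = 2 * M + j := by
    obtain ⟨r, hr⟩ := hKj
    exact ⟨r - j, by omega⟩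
  have hM2 : (K - j) / 2 = M := by omega
  have h1 : M * returnProb M ≤ Real.sqrt (K / (2 * Real.pi)) := by
    refine (mul_returnProb_le M).trans (Real.sqrt_le_sqrt ?_)
    rw [div_le_div_iff₀ Real.pi_pos (by positivity)]
    have : (2 : ℝ) * M ≤ K := by exact_mod_cast (by omega : 2 * M ≤ K)
    have := Real.pi_pos
    nlinarith
  rw [blockTerm, hM2, hermiteWeight_eq, ← hM]
  have h2 := descFactorial_le_pow_mul_exp hK j
  have h3 : ((Real.sqrt K * ρ⁻¹) ^ j) ^ 2 = K ^ j * (ρ⁻¹ ^ j) ^ 2 := by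
    rw [mul_pow, mul_pow, ← pow_mul, mul_comm j 2, pow_mul, Real.sq_sqrt (by positivity)]
  rw [div_pow _ (j.factorial : ℝ), div_pow _ (j.factorial : ℝ), h3]
  calc _ = (M * returnProb M) * ((K.descFactorial j : ℝ) *
        ((ρ⁻¹ ^ j) ^ 2 / (j.factorial : ℝ) ^ 2 / (j + 1 / 2))) := by ring
    _ ≤ Real.sqrt (K / (2 * Real.pi)) * ((K ^ j * Real.exp (-(j * (j - 1)) / (2 * K))) *
        ((ρ⁻¹ ^ j) ^ 2 / (j.factorial : ℝ) ^ 2 / (j + 1 / 2))) := by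
        gcongr
    _ = _ := by ring

end UpperBound

/-! ### A test vector for the inverse matrix -/

section LowerBound

/-- Consecutive weights have ratio at most `((2m + j + 2) / (2m + 2))²`, hence at most `q⁻²` when `q
> 0`; the hypothesis at `m` persists for larger `m` because `q ≤ 1`. -/
theorem sqrt_hermiteWeight_add_mul_le {m j : ℕ} {q : ℝ} (hq : 0 ≤ q) (hq1 : q ≤ 1)
    (hm : q * (2 * m + j) ≤ 2 * m) (i : ℕ) :
    Real.sqrt (hermiteWeight (m + i) j) * q ^ i ≤ Real.sqrt (hermiteWeight m j) := by
  induction i with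
  | zero => simp
  | succ i ih =>
    refine le_trans ?_ ih
    rw [pow_succ', ← mul_assoc]
    refine mul_le_mul_of_nonneg_right ?_ (by positivity)
    refine Real.le_sqrt_of_sq_le ?_
    rw [mul_pow, Real.sq_sqrt (hermiteWeight_pos _ _).le]
    have h := hermiteWeight_succ (m + i) j
    have h0 := hermiteWeight_pos (m + i) j
    have h1 := hermiteWeight_pos (m + i + 1) j
    set s : ℝ := ((m + i : ℕ) : ℝ) with hs
    have hs' : s = m + i := by rw [hs]; push_cast; ring
    have hs0 : 0 ≤ s := by positivity
    have hi : (0 : ℝ) ≤ i := by positivity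
    have h2 : q * (2 * s + j + 2) ≤ 2 * (s + 1) := by rw [hs']; nlinarith
    have h3 : (q * (2 * s + j + 2)) ^ 2 ≤ (2 * (s + 1)) ^ 2 := by gcongr
    have hp : 0 < (2 * s + j + 2) ^ 2 := by positivity
    refine le_of_mul_le_mul_right ?_ hp
    calc hermiteWeight (m + i + 1) j * q ^ 2 * (2 * s + j + 2) ^ 2 =
        hermiteWeight (m + i + 1) j * (q * (2 * s + j + 2)) ^ 2 := by ring
      _ ≤ hermiteWeight (m + i + 1) j * (2 * (s + 1)) ^ 2 := by gcongr
      _ = hermiteWeight (m + i) j * ((2 * s + j + 2) * (2 * s + j + 1)) := by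
        rw [← h]; ring
      _ ≤ _ := by
        refine mul_le_mul_of_nonneg_left ?_ h0.le
        rw [sq]
        refine mul_le_mul_of_nonneg_left (by linarith) (by positivity)

theorem sq_orthoCoeff_mul_pow_le {ρ : ℝ} (hρ : 0 < ρ) {m i j : ℕ} {q : ℝ} (hq : 0 ≤ q)
    (hq1 : q ≤ 1) (hm : q * (2 * m + j) ≤ 2 * m) :
    orthoCoeff ρ (2 * (m + i) + j) j ^ 2 * q ^ i ≤
      (-1) ^ i * (orthoCoeff ρ (2 * m + j) j * orthoCoeff ρ (2 * (m + i) + j) j) := by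
  rw [orthoCoeff_two_mul_add, orthoCoeff_two_mul_add]
  have h := sqrt_hermiteWeight_add_mul_le hq hq1 hm i
  have hs : ∀ n : ℕ, ((-1 : ℝ) ^ n) * (-1) ^ n = 1 := fun n => by
    rw [← mul_pow]; norm_num
  set A := Real.sqrt (hermiteWeight (m + i) j)
  set B := Real.sqrt (hermiteWeight m j)
  set F : ℝ := (j.factorial : ℝ) * ρ ^ j
  have hF : 0 < F := by positivity
  have hA : 0 ≤ A := Real.sqrt_nonneg _
  calc ((-1) ^ (m + i) * (A / F)) ^ 2 * q ^ i =
      ((-1) ^ (m + i) * (-1) ^ (m + i)) * ((A * q ^ i) * (A / F ^ 2)) := by ring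
    _ ≤ ((-1) ^ (m + i) * (-1) ^ (m + i)) * (B * (A / F ^ 2)) := by
      rw [hs, one_mul, one_mul]
      exact mul_le_mul_of_nonneg_right h (by positivity)
    _ = _ := by rw [pow_add]; ring

/-- The test vector `y` is row `T` of `C` restricted to `j ≤ J`, so `|y|² = A`. Row `T - 2i` pairs
with it to at least `A q ^ i` in absolute value, since all products share the sign `(-1) ^ i`. -/
theorem momentEigenvalueMin_mul_le_one {Ω : Type*} [MeasurableSpace Ω] {P : Measure Ω}
    {w : Ω → ℝ} {ρ : ℝ} (hρ : 0 < ρ)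
    (hw : HasLaw w (gaussianReal 0 (Real.toNNReal (ρ ^ 2))) P) {T I J : ℕ} (hJ : J + 2 * I < T) :
    momentEigenvalueMin P w T *
      ((∑ j ∈ Finset.range (J + 1) with Even (T + j), orthoCoeff ρ T j ^ 2) *
        ∑ i ∈ Finset.range (I + 1), (1 - (J : ℝ) / (T - 2 * I)) ^ (2 * i)) ≤ 1 := by
  set l := momentEigenvalueMin P w T with hl
  -- Chosen so that `q (2m + j) ≤ 2m` whenever `j ≤ J` and `2m + j ≥ T - 2I`.
  set q : ℝ := 1 - (J : ℝ) / (T - 2 * I) with hqdef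
  set A := ∑ j ∈ Finset.range (J + 1) with Even (T + j), orthoCoeff ρ T j ^ 2 with hA
  have hl0 : 0 < l := momentEigenvalueMin_pos T hρ hw
  have hk0 : (J : ℝ) < T - 2 * I := by
    have : (J : ℝ) + 2 * I < T := by exact_mod_cast hJ
    linarith
  have hJ0 : (0 : ℝ) ≤ J := by positivity
  have hq : 0 ≤ q := by
    rw [hqdef, sub_nonneg, div_le_one (by linarith)]
    exact hk0.le
  have hq1 : q ≤ 1 := by
    rw [hqdef]
    have : 0 ≤ (J : ℝ) / (T - 2 * I) := div_nonneg hJ0 (by linarith)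
    linarith
  have hA0 : 0 ≤ A := Finset.sum_nonneg fun _ _ => sq_nonneg _
  set s := (Finset.range (J + 1)).filter (fun j => Even (T + j)) with hs
  set y : ℕ → ℝ := fun j => if j ∈ s then orthoCoeff ρ T j else 0 with hy
  have hsub : s ⊆ Finset.range (T + 1) :=
    (Finset.filter_subset _ _).trans (Finset.range_mono (by omega))
  have hsum : ∀ f : ℕ → ℝ, ∑ j : Fin (T + 1), f j * y j = ∑ j ∈ s, f j * orthoCoeff ρ T j := by
    intro f
    rw [← Finset.sum_range (fun j => f j * y j)]
    simp only [hy, mul_ite, mul_zero]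
    rw [← Finset.sum_filter, Finset.filter_mem_eq_inter, Finset.inter_eq_right.2 hsub]
  have hyy : ∑ j : Fin (T + 1), y j ^ 2 = A := by
    simp only [sq]
    rw [hsum y, hA]
    refine Finset.sum_congr rfl fun j hj => ?_
    simp only [hy, if_pos hj, sq]
  have hkey : ∀ i ∈ Finset.range (I + 1),
      A ^ 2 * q ^ (2 * i) ≤ (∑ j ∈ s, orthoCoeff ρ (T - 2 * i) j * orthoCoeff ρ T j) ^ 2 := by
    intro i hi
    rw [Finset.mem_range] at hi
    have h1 : A * q ^ i ≤ (-1) ^ i * ∑ j ∈ s, orthoCoeff ρ (T - 2 * i) j * orthoCoeff ρ T j := by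
      rw [hA, Finset.sum_mul, Finset.mul_sum]
      refine Finset.sum_le_sum fun j hj => ?_
      rw [hs, Finset.mem_filter, Finset.mem_range] at hj
      obtain ⟨m, hm⟩ : ∃ m, T = 2 * (m + i) + j := by
        obtain ⟨r, hr⟩ := hj.2
        exact ⟨r - j - i, by omega⟩
      have hTi : T - 2 * i = 2 * m + j := by omega
      rw [hTi]
      have hc := sq_orthoCoeff_mul_pow_le hρ (m := m) (i := i) (j := j) hq hq1
      rw [← hm] at hc
      refine hc ?_
      have hjJ : (j : ℝ) ≤ J := by exact_mod_cast (by omega : j ≤ J)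
      have hge : (T : ℝ) - 2 * I ≤ 2 * m + j := by
        have : (T : ℝ) ≤ 2 * m + j + 2 * I := by
          exact_mod_cast (by omega : T ≤ 2 * m + j + 2 * I)
        linarith
      have : (j : ℝ) ≤ J / (T - 2 * I) * (2 * m + j) := by
        rw [div_mul_eq_mul_div, le_div_iff₀ (by linarith)]
        exact mul_le_mul hjJ hge (by linarith) hJ0
      rw [hqdef]
      linarith
    calc A ^ 2 * q ^ (2 * i) = (A * q ^ i) ^ 2 := by rw [mul_pow, ← pow_mul, mul_comm i]
      _ ≤ ((-1) ^ i * ∑ j ∈ s, orthoCoeff ρ (T - 2 * i) j * orthoCoeff ρ T j) ^ 2 := by gcongr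
      _ = _ := by rw [mul_pow, ← pow_mul, mul_comm i, pow_mul]; simp
  have hmain := momentEigenvalueMin_mul_sum_le T hρ hw (fun j => y j)
  rw [hyy] at hmain
  have hk : ∀ k : ℕ, ∑ j : Fin (T + 1), orthoCoeff ρ k j * y j =
      ∑ j ∈ s, orthoCoeff ρ k j * orthoCoeff ρ T j := fun k => hsum (orthoCoeff ρ k)
  simp only [hk] at hmain
  rw [← Finset.sum_range (fun k => (∑ j ∈ s, orthoCoeff ρ k j * orthoCoeff ρ T j) ^ 2)] at hmain
  have hinj : Set.InjOn (fun i => T - 2 * i) (Finset.range (I + 1) : Set ℕ) := by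
    intro a ha b hb h
    simp only [Finset.coe_range, Set.mem_Iio] at ha hb h
    omega
  have h2 : ∑ i ∈ Finset.range (I + 1), A ^ 2 * q ^ (2 * i) ≤
      ∑ k ∈ Finset.range (T + 1), (∑ j ∈ s, orthoCoeff ρ k j * orthoCoeff ρ T j) ^ 2 := by
    refine (Finset.sum_le_sum hkey).trans ?_
    rw [← Finset.sum_image (f := fun k => (∑ j ∈ s, orthoCoeff ρ k j * orthoCoeff ρ T j) ^ 2) hinj]
    refine Finset.sum_le_sum_of_subset_of_nonneg ?_ fun _ _ _ => sq_nonneg _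
    intro k hk
    rw [Finset.mem_image] at hk
    obtain ⟨i, _, rfl⟩ := hk
    rw [Finset.mem_range]
    omega
  rw [← Finset.mul_sum] at h2
  have h3 := (mul_le_mul_of_nonneg_left h2 hl0.le).trans hmain
  rcases hA0.eq_or_lt with h0 | h0
  · rw [← h0]; simp
  · refine le_of_mul_le_mul_right ?_ h0
    linarith [h3]

theorem le_sq_orthoCoeff {ρ : ℝ} {K j : ℕ} (hj : 2 * j ≤ K) (hKj : Even (K + j)) :
    Real.sqrt (2 / (Real.pi * (K + 1))) *
      (Real.exp (-(j : ℝ) ^ 2 / (2 * K) - (j : ℝ) ^ 3 / K ^ 2) *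
        ((Real.sqrt K * ρ⁻¹) ^ j / j.factorial) ^ 2) ≤ orthoCoeff ρ K j ^ 2 := by
  obtain ⟨M, hM⟩ : ∃ M, K = 2 * M + j := by
    obtain ⟨r, hr⟩ := hKj
    exact ⟨r - j, by omega⟩
  have h0 : orthoCoeff ρ K j ^ 2 = returnProb M * (K.descFactorial j : ℝ) *
      (ρ⁻¹ ^ j / j.factorial) ^ 2 := by
    rw [hM, sq_orthoCoeff_two_mul_add, hermiteWeight_eq]
  have h1 : Real.sqrt (2 / (Real.pi * (K + 1))) ≤ returnProb M := by
    refine le_trans (Real.sqrt_le_sqrt ?_) (le_returnProb M)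
    have := Real.pi_pos
    have : (2 : ℝ) * M ≤ K := by exact_mod_cast (by omega : 2 * M ≤ K)
    gcongr
  have h2 := pow_mul_exp_le_descFactorial hj
  have h3 : ((Real.sqrt K * ρ⁻¹) ^ j) ^ 2 = K ^ j * (ρ⁻¹ ^ j) ^ 2 := by
    rw [mul_pow, mul_pow, ← pow_mul, mul_comm j 2, pow_mul, Real.sq_sqrt (by positivity)]
  rw [h0, div_pow _ (j.factorial : ℝ), div_pow _ (j.factorial : ℝ), h3]
  have := (returnProb_pos M).le
  calc _ = Real.sqrt (2 / (Real.pi * (K + 1))) * (K ^ j *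
        Real.exp (-(j : ℝ) ^ 2 / (2 * K) - (j : ℝ) ^ 3 / K ^ 2)) *
          ((ρ⁻¹ ^ j) ^ 2 / (j.factorial : ℝ) ^ 2) := by ring
    _ ≤ _ := by gcongr

end LowerBound

/-! ### Modified Bessel sums: parity, concentration, asymptotics -/

section Bessel

open Filter Topology

/-- The weight `(x ^ j / j !) ^ 2` of the power series of the modified Bessel function. -/
noncomputable def besselWeight (x : ℝ) (j : ℕ) : ℝ := (x ^ j / j.factorial) ^ 2

theorem besselWeight_nonneg (x : ℝ) (j : ℕ) : 0 ≤ besselWeight x j := sq_nonneg _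

theorem integral_sin_pow_two_mul (n : ℕ) :
    ∫ θ in (0 : ℝ)..Real.pi, Real.sin θ ^ (2 * n) =
      Real.pi * ((2 * n).factorial / ((n.factorial : ℝ) ^ 2 * 4 ^ n)) := by
  rw [integral_sin_pow_even]
  congr 1
  induction n with
  | zero => simp
  | succ n ih =>
    rw [Finset.prod_range_succ, ih, show 2 * (n + 1) = 2 * n + 1 + 1 by ring,
      Nat.factorial_succ (2 * n + 1), Nat.factorial_succ (2 * n), Nat.factorial_succ n]
    push_cast
    field_simp
    ring

/-- The Wallis integral represents `(x ^ n / n!)²` as the mean of `(2 x sin θ) ^ (2n) / (2n)!` over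
`[0, π]`. Summing termwise, `s = 1` gives `cosh` and `s = -1` gives `cos`. -/
theorem hasSum_pow_mul_besselWeight {s : ℝ} (hs : |s| = 1) (x : ℝ) {f : ℝ → ℝ}
    (hf : ∀ r, HasSum (fun n : ℕ => s ^ n * (r ^ (2 * n) / (2 * n).factorial)) (f r)) :
    HasSum (fun n => s ^ n * besselWeight x n)
      (Real.pi⁻¹ * ∫ θ in (0 : ℝ)..Real.pi, f (2 * x * Real.sin θ)) := by
  have h : HasSum (fun n : ℕ => ∫ θ in (0 : ℝ)..Real.pi,
      s ^ n * ((2 * x * Real.sin θ) ^ (2 * n) / (2 * n).factorial))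
      (∫ θ in (0 : ℝ)..Real.pi, f (2 * x * Real.sin θ)) := by
    have hsum : Summable fun n : ℕ => |2 * x| ^ (2 * n) / ((2 * n).factorial : ℝ) :=
      (Real.summable_pow_div_factorial |2 * x|).comp_injective
        (mul_right_injective₀ (two_ne_zero : (2 : ℕ) ≠ 0))
    refine intervalIntegral.hasSum_integral_of_dominated_convergence
      (fun n _ => |2 * x| ^ (2 * n) / (2 * n).factorial) (fun n => ?_) (fun n => ?_) ?_ ?_ ?_
    · exact (Continuous.aestronglyMeasurable (by fun_prop))
    · refine Eventually.of_forall fun θ _ => ?_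
      rw [norm_mul, norm_pow, Real.norm_eq_abs, hs, one_pow, one_mul, norm_div, norm_pow,
        Real.norm_eq_abs, Real.norm_of_nonneg (Nat.cast_nonneg _)]
      refine div_le_div_of_nonneg_right (pow_le_pow_left₀ (abs_nonneg _) ?_ _) (by positivity)
      rw [abs_mul]
      exact mul_le_of_le_one_right (abs_nonneg _) (Real.abs_sin_le_one θ)
    · exact Eventually.of_forall fun θ _ => hsum
    · exact intervalIntegrable_const
    · exact Eventually.of_forall fun θ _ => hf _
  have h2 := h.mul_left Real.pi⁻¹
  refine h2.congr_fun fun n => ?_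
  simp only [mul_pow (2 * x), mul_div_right_comm _ _ ((2 * n).factorial : ℝ)]
  rw [intervalIntegral.integral_const_mul, intervalIntegral.integral_const_mul,
    integral_sin_pow_two_mul, besselWeight]
  have hpi := Real.pi_pos
  have : (4 : ℝ) ^ n = 2 ^ n * 2 ^ n := by rw [← mul_pow]; norm_num
  rw [this]
  field_simp
  ring

/-- The power series `∑ (x ^ j / j !) ^ 2`, a modified Bessel function at `2 * x`. -/
noncomputable def besselSum (x : ℝ) : ℝ := ∑' j, besselWeight x j

theorem hasSum_besselWeight_integral (x : ℝ) : HasSum (besselWeight x)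
    (Real.pi⁻¹ * ∫ θ in (0 : ℝ)..Real.pi, Real.cosh (2 * x * Real.sin θ)) := by
  have := hasSum_pow_mul_besselWeight (s := 1) (by simp) x (f := Real.cosh)
    (fun r => by simpa using Real.hasSum_cosh r)
  simpa using this

theorem summable_besselWeight (x : ℝ) : Summable (besselWeight x) :=
  (hasSum_besselWeight_integral x).summable

theorem hasSum_besselWeight (x : ℝ) : HasSum (besselWeight x) (besselSum x) :=
  (summable_besselWeight x).hasSum

theorem exists_hasSum_alternating_besselWeight (x : ℝ) :
    ∃ r : ℝ, |r| ≤ 1 ∧ HasSum (fun n => (-1) ^ n * besselWeight x n) r := by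
  refine ⟨_, ?_, hasSum_pow_mul_besselWeight (s := -1) (by simp) x (f := Real.cos)
    (fun r => by simpa only [mul_div_assoc] using Real.hasSum_cos r)⟩
  have hpi := Real.pi_pos
  have h := intervalIntegral.norm_integral_le_of_norm_le_const (a := 0) (b := Real.pi) (C := 1)
    (f := fun θ => Real.cos (2 * x * Real.sin θ)) (fun θ _ => Real.abs_cos_le_one _)
  rw [abs_mul, abs_of_pos (inv_pos.2 hpi), inv_mul_le_iff₀ hpi]
  simpa [abs_of_pos hpi] using h

/-- The part of `besselSum` over the indices with the parity of `p`. -/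
noncomputable def paritySum (p : ℕ) (x : ℝ) : ℝ :=
  ∑' j, if Even (p + j) then besselWeight x j else 0

theorem hasSum_paritySum (p : ℕ) (x : ℝ) :
    HasSum (fun j => if Even (p + j) then besselWeight x j else 0) (paritySum p x) :=
  ((summable_besselWeight x).of_nonneg_of_le
    (fun j => by split_ifs; exacts [besselWeight_nonneg x j, le_rfl])
    (fun j => by split_ifs; exacts [le_rfl, besselWeight_nonneg x j])).hasSum

/-- Adding or subtracting the alternating sum selects a parity, and that sum is bounded by 1. -/
theorem abs_two_mul_paritySum_sub_le (p : ℕ) (x : ℝ) :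
    |2 * paritySum p x - besselSum x| ≤ 1 := by
  obtain ⟨r, hr, h⟩ := exists_hasSum_alternating_besselWeight x
  have h1 := (hasSum_besselWeight x).add (h.mul_left ((-1) ^ p))
  have h2 : (fun j => besselWeight x j + (-1) ^ p * ((-1) ^ j * besselWeight x j)) =
      fun j => 2 * if Even (p + j) then besselWeight x j else 0 := by
    ext j
    rw [← mul_assoc, ← pow_add]
    split_ifs with hp
    · rw [hp.neg_one_pow]; ring
    · rw [(Nat.not_even_iff_odd.1 hp).neg_one_pow]; ring
  rw [h2] at h1
  rw [((hasSum_paritySum p x).mul_left 2).unique h1, add_sub_cancel_left, abs_mul, abs_pow]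
  simpa using hr

/-- `j²` times the weight at `j` is `x²` times the weight at `j - 1`, and the term `j = 0` vanishes.
-/
theorem hasSum_sq_mul_besselWeight {x s : ℝ} {f : ℕ → ℝ}
    (h : HasSum (fun j => f (j + 1) * besselWeight x j) s) :
    HasSum (fun j : ℕ => (j : ℝ) ^ 2 * f j * besselWeight x j) (x ^ 2 * s) := by
  rw [← hasSum_nat_add_iff' 1]
  have := h.mul_left (x ^ 2)
  simp only [Finset.range_one, Finset.sum_singleton, Nat.cast_zero, ne_eq, two_ne_zero,
    not_false_eq_true, zero_pow, zero_mul, sub_zero]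
  refine this.congr_fun fun j => ?_
  rw [besselWeight, besselWeight, Nat.factorial_succ]
  push_cast
  field_simp
  ring

/-- Under the normalised weights `j²` has mean exactly `x²`, by the index shift. A second shift
gives its variance `x² (2 E[j] + 1)`, and `E[j] ≤ x` follows from `2 x j ≤ j² + x²`. -/
theorem tsum_sq_sub_sq_mul_besselWeight_le {x : ℝ} (hx : 0 < x) :
    ∃ r, HasSum (fun j : ℕ => ((j : ℝ) ^ 2 - x ^ 2) ^ 2 * besselWeight x j) r ∧
      r ≤ x ^ 2 * (2 * x + 1) * besselSum x := by
  have h0 := hasSum_besselWeight x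
  have h2 : HasSum (fun j : ℕ => (j : ℝ) ^ 2 * besselWeight x j) (x ^ 2 * besselSum x) := by
    have := hasSum_sq_mul_besselWeight (x := x) (s := besselSum x) (f := fun _ => 1)
      (by simpa using h0)
    simpa using this
  have h1 : Summable fun j : ℕ => (j : ℝ) * besselWeight x j := by
    refine h2.summable.of_nonneg_of_le
      (fun j => mul_nonneg (Nat.cast_nonneg j) (besselWeight_nonneg x j))
      (fun j => mul_le_mul_of_nonneg_right ?_ (besselWeight_nonneg x j))
    exact_mod_cast Nat.le_self_pow two_ne_zero j
  obtain ⟨m, hm⟩ := h1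
  have hmle : m ≤ x * besselSum x := by
    have := hasSum_le (fun j => ?_) (hm.mul_left (2 * x)) (h2.add (h0.mul_left (x ^ 2)))
    · have h3 : 2 * x * m ≤ 2 * x * (x * besselSum x) := by linarith
      exact le_of_mul_le_mul_left h3 (by positivity)
    · have := mul_nonneg (sq_nonneg ((j : ℝ) - x)) (besselWeight_nonneg x j)
      linarith
  have h4 := hasSum_sq_mul_besselWeight (x := x) (f := fun j : ℕ => (j : ℝ) ^ 2 - x ^ 2)
    (s := x ^ 2 * besselSum x + (2 * m + besselSum x) - x ^ 2 * besselSum x)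
    (by
      refine (((h2.add ((hm.mul_left 2).add h0))).sub (h0.mul_left (x ^ 2))).congr_fun fun j => ?_
      push_cast
      ring)
  refine ⟨_, (h4.sub ((h2.sub (h0.mul_left (x ^ 2))).mul_left (x ^ 2))).congr_fun fun j => ?_, ?_⟩
  · ring
  · have : x ^ 2 * (2 * m) ≤ x ^ 2 * (2 * (x * besselSum x)) := by gcongr
    linarith

/-- Chebyshev's inequality for `j²`. -/
theorem sum_besselWeight_le_of_le_abs {x δ : ℝ} (hx : 0 < x) (hδ : 0 < δ) {s : Finset ℕ}
    (hs : ∀ j ∈ s, δ * x ^ 2 ≤ |(j : ℝ) ^ 2 - x ^ 2|) :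
    ∑ j ∈ s, besselWeight x j ≤ (2 * x + 1) / (x ^ 2 * δ ^ 2) * besselSum x := by
  obtain ⟨r, hr, hle⟩ := tsum_sq_sub_sq_mul_besselWeight_le hx
  have h1 : ∑ j ∈ s, ((j : ℝ) ^ 2 - x ^ 2) ^ 2 * besselWeight x j ≤ r :=
    sum_le_hasSum s (fun j _ => mul_nonneg (sq_nonneg _) (besselWeight_nonneg x j)) hr
  have h2 : (δ * x ^ 2) ^ 2 * ∑ j ∈ s, besselWeight x j ≤
      ∑ j ∈ s, ((j : ℝ) ^ 2 - x ^ 2) ^ 2 * besselWeight x j := by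
    rw [Finset.mul_sum]
    refine Finset.sum_le_sum fun j hj => mul_le_mul_of_nonneg_right ?_ (besselWeight_nonneg x j)
    rw [← sq_abs ((j : ℝ) ^ 2 - x ^ 2)]
    have := hs j hj
    gcongr
  rw [div_mul_eq_mul_div, le_div_iff₀ (by positivity)]
  refine le_of_mul_le_mul_left ?_ (by positivity : 0 < x ^ 2)
  linarith [h2.trans (h1.trans hle)]

/-- Laplace's method: after `θ = u / √x` the integrand tends to `exp (-u²)`, and `cos θ ≤ 1 - 2 θ² /
π²` supplies a Gaussian majorant. -/
theorem tendsto_sqrt_mul_integral_exp_cos :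
    Tendsto (fun x : ℝ => Real.sqrt x *
      ∫ θ in (-(Real.pi / 2))..(Real.pi / 2), Real.exp (2 * x * (Real.cos θ - 1)))
      atTop (𝓝 (Real.sqrt Real.pi)) := by
  have hpi := Real.pi_pos
  have hlim : Tendsto (fun x : ℝ => ∫ u, (Set.Ioc (-(Real.sqrt x * (Real.pi / 2)))
      (Real.sqrt x * (Real.pi / 2))).indicator
      (fun u => Real.exp (2 * x * (Real.cos (u / Real.sqrt x) - 1))) u)
      atTop (𝓝 (∫ u, Real.exp (-1 * u ^ 2))) := by
    refine tendsto_integral_filter_of_dominated_convergence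
      (fun u => Real.exp (-(4 / Real.pi ^ 2) * u ^ 2)) ?_ ?_ ?_ ?_
    · refine Eventually.of_forall fun x => ?_
      refine Measurable.aestronglyMeasurable (Measurable.indicator ?_ measurableSet_Ioc)
      fun_prop
    · filter_upwards [eventually_gt_atTop 0] with x hx
      refine Eventually.of_forall fun u => ?_
      have hsx : 0 < Real.sqrt x := Real.sqrt_pos.2 hx
      by_cases hu : u ∈ Set.Ioc (-(Real.sqrt x * (Real.pi / 2))) (Real.sqrt x * (Real.pi / 2))
      · rw [Set.indicator_of_mem hu, Real.norm_of_nonneg (Real.exp_pos _).le, Real.exp_le_exp]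
        have habs : |u / Real.sqrt x| ≤ Real.pi := by
          rw [abs_div, abs_of_pos hsx, div_le_iff₀ hsx, abs_le]
          constructor <;> nlinarith [hu.1, hu.2, mul_pos hsx hpi]
        have hc := Real.cos_le_one_sub_mul_cos_sq habs
        have h1 : (u / Real.sqrt x) ^ 2 = u ^ 2 / x := by rw [div_pow, Real.sq_sqrt hx.le]
        rw [h1] at hc
        calc 2 * x * (Real.cos (u / Real.sqrt x) - 1) ≤
            2 * x * (-(2 / Real.pi ^ 2 * (u ^ 2 / x))) := by
              gcongr; linarith
          _ = _ := by field_simp; ring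
      · rw [Set.indicator_of_notMem hu, norm_zero]
        positivity
    · exact integrable_exp_neg_mul_sq (by positivity)
    · refine Eventually.of_forall fun u => ?_
      have hs : Tendsto Real.sqrt atTop atTop := Real.tendsto_sqrt_atTop
      -- By `cos θ - 1 = -2 sin² (θ / 2)`, the exponent is exactly `-u² sinc² (u / (2 √x))` once `u`
      -- lies in the window.
      have h1 : Tendsto (fun x => -1 * u ^ 2 * Real.sinc (u / (2 * Real.sqrt x)) ^ 2) atTop
          (𝓝 (-1 * u ^ 2)) := by
        have : Tendsto (fun x => Real.sinc (u / (2 * Real.sqrt x))) atTop (𝓝 1) := by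
          rw [← Real.sinc_zero]
          exact (Real.continuous_sinc.tendsto 0).comp
            ((hs.const_mul_atTop two_pos).const_div_atTop u)
        have h := (this.pow 2).const_mul (-1 * u ^ 2)
        rwa [one_pow, mul_one] at h
      refine ((Real.continuous_exp.tendsto _).comp h1).congr' ?_
      have h2 := (hs.atTop_mul_const (by positivity : 0 < Real.pi / 2)).eventually_gt_atTop |u|
      filter_upwards [h2, eventually_gt_atTop 0] with x hx hx0
      have hsx : 0 < Real.sqrt x := Real.sqrt_pos.2 hx0
      rw [abs_lt] at hx
      rw [Set.indicator_of_mem (Set.mem_Ioc.2 ⟨hx.1, hx.2.le⟩), Function.comp]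
      congr 1
      have h3 : Real.cos (u / Real.sqrt x) - 1 = -2 * Real.sin (u / (2 * Real.sqrt x)) ^ 2 := by
        have := Real.cos_two_mul (u / (2 * Real.sqrt x))
        have h4 := Real.sin_sq_add_cos_sq (u / (2 * Real.sqrt x))
        rw [show 2 * (u / (2 * Real.sqrt x)) = u / Real.sqrt x by field_simp] at this
        rw [this]; linarith
      rw [h3]
      rcases eq_or_ne u 0 with rfl | hu
      · simp
      · rw [Real.sinc_of_ne_zero (by positivity)]
        field_simp
        rw [Real.sq_sqrt hx0.le]
        ring
  rw [integral_gaussian, div_one] at hlim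
  refine hlim.congr' ?_
  filter_upwards [eventually_gt_atTop 0] with x hx
  have hsx : 0 < Real.sqrt x := Real.sqrt_pos.2 hx
  rw [integral_indicator measurableSet_Ioc, ← intervalIntegral.integral_of_le (by
    have := mul_pos hsx hpi; linarith)]
  have := intervalIntegral.integral_comp_div (a := -(Real.sqrt x * (Real.pi / 2)))
    (b := Real.sqrt x * (Real.pi / 2)) (fun θ => Real.exp (2 * x * (Real.cos θ - 1))) hsx.ne'
  rw [this, smul_eq_mul]
  congr 2 <;> field_simp

/-- The leading asymptotics of `besselSum`. -/
noncomputable def besselAsymp (x : ℝ) : ℝ := Real.exp (2 * x) / (2 * Real.sqrt (Real.pi * x))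

theorem tendsto_besselSum_div :
    Tendsto (fun x => besselSum x / besselAsymp x) atTop (𝓝 1) := by
  have hpi := Real.pi_pos
  have hsum : ∀ x, besselSum x = (2 * Real.pi)⁻¹ *
      ((∫ θ in (0 : ℝ)..Real.pi, Real.exp (2 * x * Real.sin θ)) +
        ∫ θ in (0 : ℝ)..Real.pi, Real.exp (-(2 * x * Real.sin θ))) := by
    intro x
    rw [(hasSum_besselWeight x).unique (hasSum_besselWeight_integral x),
      ← intervalIntegral.integral_add (Continuous.intervalIntegrable (by fun_prop) _ _)
        (Continuous.intervalIntegrable (by fun_prop) _ _)]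
    simp only [Real.cosh_eq, intervalIntegral.integral_div]
    ring
  have hshift : ∀ x, ∫ θ in (0 : ℝ)..Real.pi, Real.exp (2 * x * Real.sin θ) =
      Real.exp (2 * x) *
        ∫ θ in (-(Real.pi / 2))..(Real.pi / 2), Real.exp (2 * x * (Real.cos θ - 1)) := by
    intro x
    have := intervalIntegral.integral_comp_add_right (a := -(Real.pi / 2)) (b := Real.pi / 2)
      (fun θ => Real.exp (2 * x * Real.sin θ)) (Real.pi / 2)
    rw [show -(Real.pi / 2) + Real.pi / 2 = 0 by ring,
      show Real.pi / 2 + Real.pi / 2 = Real.pi by ring] at this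
    rw [← this, ← intervalIntegral.integral_const_mul]
    refine intervalIntegral.integral_congr fun θ _ => ?_
    rw [Real.sin_add_pi_div_two, ← Real.exp_add]
    congr 1
    ring
  have hsmall : Tendsto (fun x => Real.sqrt x * Real.exp (-(2 * x)) *
      ∫ θ in (0 : ℝ)..Real.pi, Real.exp (-(2 * x * Real.sin θ))) atTop (𝓝 0) := by
    have h1 : Tendsto (fun x : ℝ => Real.sqrt x * Real.exp (-(2 * x)) * Real.pi) atTop (𝓝 0) := by
      have := (tendsto_rpow_mul_exp_neg_mul_atTop_nhds_zero (1 / 2) 2 two_pos).mul_const Real.pi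
      rw [zero_mul] at this
      refine this.congr fun x => ?_
      rw [Real.sqrt_eq_rpow, neg_mul]
    refine tendsto_of_tendsto_of_tendsto_of_le_of_le' tendsto_const_nhds h1 ?_ ?_
    · refine Eventually.of_forall fun x => ?_
      have := intervalIntegral.integral_nonneg (μ := volume) hpi.le
        (fun θ _ => (Real.exp_pos (-(2 * x * Real.sin θ))).le)
      positivity
    · filter_upwards [eventually_ge_atTop 0] with x hx
      refine mul_le_mul_of_nonneg_left ?_ (by positivity)
      have := intervalIntegral.integral_mono_on (μ := volume) (a := 0) (b := Real.pi)
        (f := fun θ => Real.exp (-(2 * x * Real.sin θ))) (g := fun _ => 1) hpi.le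
        (Continuous.intervalIntegrable (by fun_prop) _ _) intervalIntegrable_const
        (fun θ hθ => by
          rw [Real.exp_le_one_iff, neg_nonpos]
          have := Real.sin_nonneg_of_mem_Icc hθ
          positivity)
      simpa using this
  have h := (tendsto_sqrt_mul_integral_exp_cos.add hsmall).const_mul (Real.sqrt Real.pi / Real.pi)
  rw [add_zero, div_mul_eq_mul_div, Real.mul_self_sqrt hpi.le, div_self hpi.ne'] at h
  refine h.congr' ?_
  filter_upwards [eventually_gt_atTop 0] with x hx
  have hsx : 0 < Real.sqrt x := Real.sqrt_pos.2 hx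
  rw [hsum, hshift, besselAsymp, Real.exp_neg, Real.sqrt_mul hpi.le]
  have := Real.exp_pos (2 * x)
  field_simp

end Bessel

/-! ### Explicit bounds with a window around the mode -/

section SmallestEigenvalueBounds

theorem besselWeight_succ (x : ℝ) (j : ℕ) :
    besselWeight x (j + 1) * ((j : ℝ) + 1) ^ 2 = x ^ 2 * besselWeight x j := by
  rw [besselWeight, besselWeight, Nat.factorial_succ]
  push_cast
  field_simp
  ring

/-- For `j ≥ (1 - ε) x` the factors `1 / (j + 1/2)` and the exponential are controlled by their
values at the cut, so no upper cut is needed. Smaller `j` lie in the Chebyshev tail. -/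
theorem blockTrace_le {ρ ε x : ℝ} {K : ℕ} (hK : 0 < K) (hx : x = Real.sqrt K * ρ⁻¹) (hx0 : 0 < x)
    (hε : 0 < ε) (hε1 : ε < 1) (h1 : 1 ≤ (1 - ε) * x) (h2 : 2 ≤ ε * x) :
    blockTrace ρ K ≤ Real.sqrt (K / (2 * Real.pi)) / x *
      (Real.exp (-((1 - ε) * x * ((1 - ε) * x - 1)) / (2 * K)) / (1 - ε) * paritySum K x +
        2 * ((2 * x + 1) / (x ^ 2 * (ε / 2) ^ 2) * besselSum x)) := by
  set y := (1 - ε) * x with hy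
  set A := Real.exp (-(y * (y - 1)) / (2 * K)) / (1 - ε) with hA
  have hK' : (0 : ℝ) < K := by exact_mod_cast hK
  have hε1' : 0 < 1 - ε := by linarith
  set s := (Finset.range K).filter (fun j => Even (K + j)) with hs
  have hterm : ∀ j ∈ s, blockTerm ρ K j ≤ Real.sqrt (K / (2 * Real.pi)) / x *
      (A * besselWeight x j + if (j : ℝ) < y then 2 * besselWeight x (j + 1) else 0) := by
    intro j hj
    rw [hs, Finset.mem_filter, Finset.mem_range] at hj
    refine (blockTerm_le hK hj.1.le hj.2).trans ?_
    rw [← hx, div_mul_eq_mul_div (Real.sqrt (K / (2 * Real.pi))) x,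
      mul_div_assoc (Real.sqrt (K / (2 * Real.pi)))]
    refine mul_le_mul_of_nonneg_left ?_ (Real.sqrt_nonneg _)
    rw [show ((x ^ j / j.factorial : ℝ)) ^ 2 = besselWeight x j from rfl]
    have hw := besselWeight_nonneg x j
    have hw1 := besselWeight_nonneg x (j + 1)
    rw [le_div_iff₀ hx0]
    have hj0 : (0 : ℝ) ≤ j := Nat.cast_nonneg j
    split_ifs with hjy
    · have hE : Real.exp (-((j : ℝ) * (j - 1)) / (2 * K)) ≤ 1 := by
        rw [Real.exp_le_one_iff]
        refine div_nonpos_of_nonpos_of_nonneg ?_ (by positivity)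
        have : (j : ℝ) ≤ (j : ℝ) ^ 2 := by exact_mod_cast Nat.le_self_pow two_ne_zero j
        nlinarith
      have hjx : (j : ℝ) + 1 ≤ x := by
        have : y = x - ε * x := by rw [hy]; ring
        linarith
      -- For small `j` the factor `x / (j + 1/2)` is large; passing to the weight at `j + 1` absorbs
      -- it.
      have h3 : besselWeight x j * x ≤ besselWeight x (j + 1) * (j + 1) := by
        have h4 := besselWeight_succ x j
        have h5 : besselWeight x j * x * x ≤ besselWeight x (j + 1) * (j + 1) * x := by
          calc besselWeight x j * x * x = besselWeight x (j + 1) * (j + 1) * (j + 1) := by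
                linarith
            _ ≤ _ := by gcongr
        exact le_of_mul_le_mul_right h5 hx0
      have h6 : Real.exp (-((j : ℝ) * (j - 1)) / (2 * K)) / (j + 1 / 2) * besselWeight x j * x ≤
          2 * besselWeight x (j + 1) := by
        calc _ = Real.exp (-((j : ℝ) * (j - 1)) / (2 * K)) * (besselWeight x j * x) /
              (j + 1 / 2) := by ring
          _ ≤ 1 * (besselWeight x (j + 1) * (j + 1)) / (j + 1 / 2) := by gcongr
          _ ≤ _ := by
            rw [div_le_iff₀ (by positivity)]
            linarith [mul_nonneg hj0 hw1]
      have : 0 ≤ A * besselWeight x j := by positivity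
      linarith
    · push Not at hjy
      rw [add_zero]
      have hE : Real.exp (-((j : ℝ) * (j - 1)) / (2 * K)) ≤
          Real.exp (-(y * (y - 1)) / (2 * K)) := by
        refine Real.exp_le_exp.2 (div_le_div_of_nonneg_right ?_ (by positivity))
        nlinarith
      have h7 : x / (j + 1 / 2) ≤ 1 / (1 - ε) := by
        rw [div_le_div_iff₀ (by positivity) hε1']
        linarith
      calc _ = Real.exp (-((j : ℝ) * (j - 1)) / (2 * K)) * (x / (j + 1 / 2)) *
            besselWeight x j := by ring
        _ ≤ Real.exp (-(y * (y - 1)) / (2 * K)) * (1 / (1 - ε)) * besselWeight x j := by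
          gcongr
        _ = _ := by rw [hA]; ring
  refine (Finset.sum_le_sum hterm).trans ?_
  rw [← Finset.mul_sum, Finset.sum_add_distrib, ← Finset.mul_sum]
  refine mul_le_mul_of_nonneg_left (add_le_add ?_ ?_) (by positivity)
  · refine mul_le_mul_of_nonneg_left ?_ (by positivity)
    rw [hs, Finset.sum_filter]
    refine sum_le_hasSum _ (fun j _ => ?_) (hasSum_paritySum K x)
    split_ifs
    exacts [besselWeight_nonneg x j, le_rfl]
  · rw [← Finset.sum_filter, ← Finset.mul_sum]
    refine mul_le_mul_of_nonneg_left ?_ two_pos.le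
    rw [← Finset.sum_image (g := fun j => j + 1) (f := besselWeight x)
      (fun a _ b _ h => Nat.succ_injective h)]
    refine sum_besselWeight_le_of_le_abs hx0 (by positivity) fun i hi => ?_
    rw [Finset.mem_image] at hi
    obtain ⟨j, hj, rfl⟩ := hi
    have hjy := (Finset.mem_filter.1 hj).2
    -- The shift by one costs half of the window, using `ε x ≥ 2`.
    have h8 : ((j + 1 : ℕ) : ℝ) ≤ (1 - ε / 2) * x := by
      push_cast
      have : (1 - ε / 2) * x = y + ε * x / 2 := by rw [hy]; ring
      linarith
    have h9 : ((j + 1 : ℕ) : ℝ) ^ 2 ≤ ((1 - ε / 2) * x) ^ 2 := by gcongr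
    rw [abs_sub_comm]
    refine le_trans ?_ (le_abs_self _)
    have h10 : 0 ≤ ε / 2 * (1 - ε / 2) * x ^ 2 := by
      have : 0 < 1 - ε / 2 := by linarith
      positivity
    nlinarith

theorem le_sum_range_besselWeight {ε x : ℝ} (hx : 0 < x) (hε : 0 < ε) (p : ℕ) {J : ℕ}
    (hJ : (1 + ε) * x < J + 1) :
    paritySum p x - (2 * x + 1) / (x ^ 2 * ε ^ 2) * besselSum x ≤
      ∑ j ∈ Finset.range (J + 1) with Even (p + j), besselWeight x j := by
  rw [sub_le_iff_le_add]
  refine hasSum_le_of_sum_le (hasSum_paritySum p x) fun F => ?_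
  rw [← Finset.sum_filter]
  rw [← Finset.sum_filter_add_sum_filter_not _ (fun j => j < J + 1)]
  refine add_le_add ?_ ?_
  · refine Finset.sum_le_sum_of_subset_of_nonneg ?_ fun _ _ _ => besselWeight_nonneg _ _
    intro j hj
    simp only [Finset.mem_filter, Finset.mem_range] at hj ⊢
    exact ⟨hj.2, hj.1.2⟩
  · refine sum_besselWeight_le_of_le_abs hx hε fun j hj => ?_
    have h1 := (Finset.mem_filter.1 hj).2
    have h2 : (1 + ε) * x ≤ j := by
      have : ((J + 1 : ℕ) : ℝ) ≤ j := by exact_mod_cast not_lt.1 h1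
      push_cast at this
      linarith
    have h3 : ((1 + ε) * x) ^ 2 ≤ (j : ℝ) ^ 2 := by gcongr
    refine le_trans ?_ (le_abs_self _)
    have : 0 ≤ (ε + ε ^ 2) * x ^ 2 := by positivity
    nlinarith

theorem le_sum_sq_orthoCoeff {ρ ε x : ℝ} {T J : ℕ} (hT : 0 < T) (hx : x = Real.sqrt T * ρ⁻¹)
    (hx0 : 0 < x) (hε : 0 < ε) (hJ1 : (J : ℝ) ≤ (1 + ε) * x) (hJ2 : (1 + ε) * x < J + 1)
    (hJT : 2 * J ≤ T) :
    Real.sqrt (2 / (Real.pi * (T + 1))) *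
      (Real.exp (-((1 + ε) * x) ^ 2 / (2 * T) - ((1 + ε) * x) ^ 3 / T ^ 2) *
        (paritySum T x - (2 * x + 1) / (x ^ 2 * ε ^ 2) * besselSum x)) ≤
      ∑ j ∈ Finset.range (J + 1) with Even (T + j), orthoCoeff ρ T j ^ 2 := by
  have hT' : (0 : ℝ) < T := by exact_mod_cast hT
  refine le_trans (mul_le_mul_of_nonneg_left (mul_le_mul_of_nonneg_left
    (le_sum_range_besselWeight hx0 hε T hJ2) (Real.exp_pos _).le) (Real.sqrt_nonneg _)) ?_
  rw [Finset.mul_sum, Finset.mul_sum]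
  refine Finset.sum_le_sum fun j hj => ?_
  rw [Finset.mem_filter, Finset.mem_range] at hj
  refine le_trans ?_ (le_sq_orthoCoeff (by omega) hj.2)
  rw [← hx]
  refine mul_le_mul_of_nonneg_left (mul_le_mul_of_nonneg_right (Real.exp_le_exp.2 ?_)
    (besselWeight_nonneg x j)) (Real.sqrt_nonneg _)
  have hjJ : (j : ℝ) ≤ (1 + ε) * x := le_trans (by exact_mod_cast (by omega : j ≤ J)) hJ1
  have hj0 : (0 : ℝ) ≤ j := Nat.cast_nonneg j
  refine sub_le_sub ?_ ?_
  · rw [neg_div, neg_div, neg_le_neg_iff]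
    gcongr
  · gcongr

/-- With `z = J / (T - 2I)` the ratio is `(1 - z)²` and `1 - (1 - z)² ≤ 2z`, so the full series is
at least `1 / (2z)`, close to `T / (2x)`. The truncation at `I ≈ ε T` costs only `exp (-2 ε x)`. -/
theorem le_sum_geom {ε x : ℝ} {T I J : ℕ} (hx : 0 < x) (hε : 0 < ε) (hxJ : x ≤ J)
    (hJ : (J : ℝ) ≤ (1 + ε) * x) (hI1 : (I : ℝ) ≤ ε * T) (hI2 : ε * T < I + 1)
    (hJI : J + 2 * I < T) :
    (1 - Real.exp (-(2 * ε * x))) * (T * (1 - 2 * ε) / (2 * ((1 + ε) * x))) ≤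
      ∑ i ∈ Finset.range (I + 1), (1 - (J : ℝ) / (T - 2 * I)) ^ (2 * i) := by
  have hT : (0 : ℝ) < T := by exact_mod_cast (by omega : 0 < T)
  have hk : (J : ℝ) < T - 2 * I := by
    have : (J : ℝ) + 2 * I < T := by exact_mod_cast hJI
    linarith
  have hJ0 : (0 : ℝ) < J := hx.trans_le hxJ
  have hI0 : (0 : ℝ) ≤ I := Nat.cast_nonneg I
  set k : ℝ := T - 2 * I with hkdef
  have hk0 : 0 < k := hJ0.trans hk
  set z : ℝ := (J : ℝ) / k with hz
  have hz0 : 0 < z := by positivity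
  have hz1 : z < 1 := by rw [hz, div_lt_one hk0]; exact hk
  simp only [pow_mul]
  have hne : (1 - z) ^ 2 ≠ 1 := by nlinarith
  rw [geom_sum_eq hne]
  have h1 : ((1 - z) ^ 2) ^ (I + 1) ≤ Real.exp (-(2 * ε * x)) := by
    have h2 : 1 - z ≤ Real.exp (-z) := by
      have := Real.add_one_le_exp (-z)
      linarith
    calc ((1 - z) ^ 2) ^ (I + 1) ≤ (Real.exp (-z) ^ 2) ^ (I + 1) := by gcongr
      _ = Real.exp (-(2 * (I + 1) * z)) := by
        rw [← pow_mul, ← Real.exp_nat_mul]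
        congr 1
        push_cast
        ring
      _ ≤ _ := by
        refine Real.exp_le_exp.2 (neg_le_neg ?_)
        have h3 : x / T ≤ z := by
          rw [hz]
          have : k ≤ T := by rw [hkdef]; linarith
          gcongr
        calc 2 * ε * x = 2 * (ε * T) * (x / T) := by field_simp
          _ ≤ 2 * (I + 1) * z := by gcongr
  have h4 : T * (1 - 2 * ε) / (2 * ((1 + ε) * x)) ≤ 1 / (1 - (1 - z) ^ 2) := by
    have h5 : 1 - (1 - z) ^ 2 ≤ 2 * z := by nlinarith
    have h6 : 0 < 1 - (1 - z) ^ 2 := by nlinarith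
    refine le_trans ?_ (one_div_le_one_div_of_le h6 h5)
    rw [div_le_div_iff₀ (by positivity) (by positivity), hz]
    have h7 : T * (1 - 2 * ε) ≤ k := by rw [hkdef]; linarith
    calc T * (1 - 2 * ε) * (2 * (J / k)) ≤ k * (2 * (J / k)) := by gcongr
      _ = 2 * J := by field_simp
      _ ≤ _ := by linarith
  have h8 : (((1 - z) ^ 2) ^ (I + 1) - 1) / ((1 - z) ^ 2 - 1) =
      (1 - ((1 - z) ^ 2) ^ (I + 1)) * (1 / (1 - (1 - z) ^ 2)) := by
    rw [← neg_div_neg_eq]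
    ring
  rw [h8]
  have h9 : 0 ≤ 1 / (1 - (1 - z) ^ 2) := by
    have : 0 < 1 - (1 - z) ^ 2 := by nlinarith
    positivity
  have h10 : Real.exp (-(2 * ε * x)) ≤ 1 := by
    rw [Real.exp_le_one_iff, neg_nonpos]
    positivity
  calc _ ≤ (1 - Real.exp (-(2 * ε * x))) * (1 / (1 - (1 - z) ^ 2)) :=
        mul_le_mul_of_nonneg_left h4 (by linarith)
    _ ≤ _ := mul_le_mul_of_nonneg_right (by linarith) h9

end SmallestEigenvalueBounds

/-! ### Limit of the smallest eigenvalue -/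

section SmallestEigenvalueAsymptotics

open Filter Topology

theorem besselAsymp_pos {x : ℝ} (hx : 0 < x) : 0 < besselAsymp x := by
  have := Real.pi_pos
  unfold besselAsymp
  positivity

/-- The leading asymptotics of the reciprocal of the smallest eigenvalue. -/
noncomputable def invEigenvalueAsymp (ρ : ℝ) (T : ℕ) : ℝ :=
  ρ / (2 * Real.sqrt (2 * Real.pi)) * Real.exp (-(1 / (2 * ρ ^ 2))) *
    besselAsymp (Real.sqrt T * ρ⁻¹)

theorem invEigenvalueAsymp_pos {ρ : ℝ} (hρ : 0 < ρ) {T : ℕ} (hT : 0 < T) :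
    0 < invEigenvalueAsymp ρ T := by
  have : (0 : ℝ) < T := by exact_mod_cast hT
  have := besselAsymp_pos (by positivity : 0 < Real.sqrt T * ρ⁻¹)
  have := Real.pi_pos
  unfold invEigenvalueAsymp
  positivity

theorem tendsto_sqrt_mul_inv_atTop {ρ : ℝ} (hρ : 0 < ρ) :
    Tendsto (fun T : ℕ => Real.sqrt T * ρ⁻¹) atTop atTop :=
  (Real.tendsto_sqrt_atTop.comp tendsto_natCast_atTop_atTop).atTop_mul_const (inv_pos.2 hρ)

/-- Needed because the block traces are taken at `T + 1` and `T + 2`; it holds since `√(T + 1) - √T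
→ 0`. -/
theorem tendsto_invEigenvalueAsymp_succ_div {ρ : ℝ} (hρ : 0 < ρ) :
    Tendsto (fun T => invEigenvalueAsymp ρ (T + 1) / invEigenvalueAsymp ρ T) atTop (𝓝 1) := by
  have hpi := Real.pi_pos
  have h1 : Tendsto (fun T : ℕ => Real.sqrt ((T : ℝ) + 1) - Real.sqrt T) atTop (𝓝 0) := by
    refine tendsto_of_tendsto_of_tendsto_of_le_of_le' tendsto_const_nhds
      (tendsto_inv_atTop_zero.comp
        (Real.tendsto_sqrt_atTop.comp tendsto_natCast_atTop_atTop) : Tendsto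
          (fun T : ℕ => (Real.sqrt T)⁻¹) atTop (𝓝 0)) ?_ ?_
    · refine Eventually.of_forall fun T => ?_
      rw [sub_nonneg]
      exact Real.sqrt_le_sqrt (by linarith)
    · filter_upwards [eventually_gt_atTop 0] with T hT
      have hT' : (0 : ℝ) < T := by exact_mod_cast hT
      have hs := Real.sqrt_pos.2 hT'
      change _ ≤ (Real.sqrt T)⁻¹
      rw [← one_div, le_div_iff₀ hs]
      have h2 := Real.sq_sqrt hT'.le
      have h3 := Real.sq_sqrt (by positivity : (0 : ℝ) ≤ T + 1)
      have h4 := Real.sqrt_nonneg ((T : ℝ) + 1)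
      nlinarith [sq_nonneg (Real.sqrt ((T : ℝ) + 1) - Real.sqrt T)]
  have h2 : Tendsto (fun T : ℕ => (T : ℝ) / (T + 1)) atTop (𝓝 1) :=
    tendsto_natCast_div_add_atTop (1 : ℝ)
  have h3 := ((Real.continuous_exp.tendsto _).comp (h1.const_mul (2 * ρ⁻¹))).mul
    (h2.sqrt.sqrt)
  simp only [mul_zero, Real.exp_zero, Real.sqrt_one, mul_one] at h3
  refine h3.congr' ?_
  filter_upwards [eventually_gt_atTop 0] with T hT
  have hT' : (0 : ℝ) < T := by exact_mod_cast hT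
  have e : ∀ t : ℝ, 0 < t → Real.sqrt (Real.pi * (Real.sqrt t * ρ⁻¹)) =
      Real.sqrt (Real.pi * ρ⁻¹) * Real.sqrt (Real.sqrt t) := by
    intro t ht
    rw [← Real.sqrt_mul (by positivity)]
    congr 1
    ring
  simp only [Function.comp, invEigenvalueAsymp, besselAsymp]
  push_cast
  rw [e _ hT', e _ (by positivity), Real.sqrt_div hT'.le, Real.sqrt_div (Real.sqrt_nonneg _),
    show 2 * ρ⁻¹ * (Real.sqrt (T + 1) - Real.sqrt T) =
      2 * (Real.sqrt (T + 1) * ρ⁻¹) - 2 * (Real.sqrt T * ρ⁻¹) by ring, Real.exp_sub]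
  have := Real.sqrt_pos.2 (Real.sqrt_pos.2 hT')
  have := Real.sqrt_pos.2 (Real.sqrt_pos.2 (by positivity : (0 : ℝ) < T + 1))
  have : 0 < Real.sqrt (Real.pi * ρ⁻¹) := by positivity
  field_simp

theorem invEigenvalueAsymp_mul_eq_one {ρ : ℝ} (hρ : 0 < ρ) {T : ℕ} (hT : 0 < T) :
    invEigenvalueAsymp ρ T * ((2 : ℝ) ^ (5 / 2 : ℝ) * Real.pi * (T : ℝ) ^ (1 / 4 : ℝ) /
      ρ ^ (3 / 2 : ℝ) * Real.exp (1 / (2 * ρ ^ 2) - 2 * Real.sqrt (T : ℝ) / ρ)) = 1 := by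
  have hpi := Real.pi_pos
  have hT' : (0 : ℝ) < T := by exact_mod_cast hT
  have h1 : (2 : ℝ) ^ (5 / 2 : ℝ) = 4 * Real.sqrt 2 := by
    rw [Real.sqrt_eq_rpow, show (5 / 2 : ℝ) = 2 + 1 / 2 by norm_num, Real.rpow_add two_pos]
    norm_num
  have h2 : ρ ^ (3 / 2 : ℝ) = ρ * Real.sqrt ρ := by
    rw [Real.sqrt_eq_rpow, show (3 / 2 : ℝ) = 1 + 1 / 2 by norm_num, Real.rpow_add hρ,
      Real.rpow_one]
  have h3 : (T : ℝ) ^ (1 / 4 : ℝ) = Real.sqrt (Real.sqrt T) := by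
    rw [Real.sqrt_eq_rpow, Real.sqrt_eq_rpow, ← Real.rpow_mul hT'.le]
    norm_num
  have h4 : Real.sqrt (Real.pi * (Real.sqrt T * ρ⁻¹)) =
      Real.sqrt Real.pi * (Real.sqrt (Real.sqrt T) / Real.sqrt ρ) := by
    rw [Real.sqrt_mul hpi.le, Real.sqrt_mul (Real.sqrt_nonneg _), Real.sqrt_inv, div_eq_mul_inv]
  have h5 : Real.exp (1 / (2 * ρ ^ 2) - 2 * Real.sqrt (T : ℝ) / ρ) =
      (Real.exp (-(1 / (2 * ρ ^ 2))))⁻¹ * (Real.exp (2 * (Real.sqrt T * ρ⁻¹)))⁻¹ := by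
    rw [← Real.exp_neg, ← Real.exp_neg, ← Real.exp_add]
    congr 1
    ring
  rw [invEigenvalueAsymp, besselAsymp, h1, h2, h3, h4, h5, Real.sqrt_mul two_pos.le]
  have a1 := Real.exp_pos (-(1 / (2 * ρ ^ 2)))
  have a2 := Real.exp_pos (2 * (Real.sqrt T * ρ⁻¹))
  have a3 := Real.sqrt_pos.2 hpi
  have a4 := Real.sqrt_pos.2 (Real.sqrt_pos.2 hT')
  have a5 := Real.sqrt_pos.2 hρ
  have a6 : (0 : ℝ) < Real.sqrt 2 := by positivity
  have a7 : Real.pi = Real.sqrt Real.pi * Real.sqrt Real.pi := (Real.mul_self_sqrt hpi.le).symm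
  set sp := Real.sqrt Real.pi
  rw [a7]
  field_simp
  norm_num

/-- The width of the window around the mode of the Bessel weights. -/
noncomputable def windowWidth (x : ℝ) : ℝ := x ^ (-(1 / 4) : ℝ)

theorem tendsto_windowWidth : Tendsto windowWidth atTop (𝓝 0) :=
  tendsto_rpow_neg_atTop (by norm_num)

theorem tendsto_windowWidth_mul : Tendsto (fun x => windowWidth x * x) atTop atTop := by
  refine (tendsto_rpow_atTop (by norm_num : (0 : ℝ) < 3 / 4)).congr' ?_
  filter_upwards [eventually_gt_atTop 0] with x hx
  rw [windowWidth, ← Real.rpow_add_one hx.ne']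
  norm_num

/-- The tail is of order `1 / (x ε²)`, so the window `ε` must tend to 0 more slowly than `x ^
(-1/2)`; the exponent `-1/4` does. -/
theorem tendsto_tail : Tendsto (fun x => (2 * x + 1) / (x ^ 2 * windowWidth x ^ 2))
    atTop (𝓝 0) := by
  have h1 : Tendsto (fun x : ℝ => (2 + x⁻¹) * x ^ (-(1 / 2) : ℝ)) atTop (𝓝 0) := by
    have := (tendsto_inv_atTop_zero (𝕜 := ℝ)).const_add 2
    simpa using this.mul (tendsto_rpow_neg_atTop (by norm_num : (0 : ℝ) < 1 / 2))
  refine h1.congr' ?_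
  filter_upwards [eventually_gt_atTop 0] with x hx
  have h2 : windowWidth x ^ 2 = x ^ (-(1 / 2) : ℝ) := by
    rw [windowWidth, ← Real.rpow_natCast, ← Real.rpow_mul hx.le]
    norm_num
  have h3 : x ^ (-(1 / 2) : ℝ) * x ^ (-(1 / 2) : ℝ) = x⁻¹ := by
    rw [← Real.rpow_add hx, ← Real.rpow_neg_one]
    norm_num
  have h4 : 0 < x ^ (-(1 / 2) : ℝ) := Real.rpow_pos_of_pos hx _
  rw [h2, eq_div_iff (by positivity)]
  calc _ = (2 + x⁻¹) * x ^ 2 * (x ^ (-(1 / 2) : ℝ) * x ^ (-(1 / 2) : ℝ)) := by ring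
    _ = _ := by rw [h3]; field_simp

theorem tendsto_inv_besselAsymp : Tendsto (fun x => (besselAsymp x)⁻¹) atTop (𝓝 0) := by
  have hpi := Real.pi_pos
  have h1 := (tendsto_rpow_mul_exp_neg_mul_atTop_nhds_zero (1 / 2) 2 two_pos).const_mul
    (2 * Real.sqrt Real.pi)
  rw [mul_zero] at h1
  refine h1.congr fun x => ?_
  rw [besselAsymp, inv_div, Real.sqrt_mul hpi.le, neg_mul, Real.exp_neg, ← Real.sqrt_eq_rpow,
    div_eq_mul_inv]
  ring

/-- The relative error in the upper bound for the block traces. -/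
noncomputable def upperError (ρ x : ℝ) : ℝ :=
  Real.exp (-((1 - windowWidth x) ^ 2 / (2 * ρ ^ 2)) + (1 - windowWidth x) / (2 * ρ ^ 2) * x⁻¹ +
    1 / (2 * ρ ^ 2)) / (1 - windowWidth x) *
      (besselSum x / besselAsymp x + (besselAsymp x)⁻¹) +
    16 * ((2 * x + 1) / (x ^ 2 * windowWidth x ^ 2)) * (besselSum x / besselAsymp x) *
      Real.exp (1 / (2 * ρ ^ 2))

theorem tendsto_upperError (ρ : ℝ) : Tendsto (upperError ρ) atTop (𝓝 1) := by
  have h1 := tendsto_windowWidth.const_sub 1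
  have h2 := ((((h1.pow 2).div_const (2 * ρ ^ 2)).neg.add ((h1.div_const (2 * ρ ^ 2)).mul
    tendsto_inv_atTop_zero)).add_const (1 / (2 * ρ ^ 2))).rexp
  have h3 := ((h2.div h1 (by norm_num)).mul (tendsto_besselSum_div.add tendsto_inv_besselAsymp)).add
    (((tendsto_tail.const_mul 16).mul tendsto_besselSum_div).mul_const
      (Real.exp (1 / (2 * ρ ^ 2))))
  refine h3.trans (le_of_eq ?_)
  congr 1
  simp

theorem eventually_blockTrace_le {ρ : ℝ} (hρ : 0 < ρ) :
    ∀ᶠ K : ℕ in atTop,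
      blockTrace ρ K ≤ upperError ρ (Real.sqrt K * ρ⁻¹) * invEigenvalueAsymp ρ K := by
  have hx := tendsto_sqrt_mul_inv_atTop hρ
  have hε := (tendsto_windowWidth.comp hx).eventually (gt_mem_nhds (by norm_num : (0 : ℝ) < 1 / 2))
  have hεx := (tendsto_windowWidth_mul.comp hx).eventually_ge_atTop 2
  filter_upwards [hx.eventually_ge_atTop 2, hε, hεx, eventually_gt_atTop 0] with K hx2 he hex hK
  simp only [Function.comp] at he hex
  have hK' : (0 : ℝ) < K := by exact_mod_cast hK
  have hxsq : (Real.sqrt K * ρ⁻¹) ^ 2 * ρ ^ 2 = K := by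
    rw [mul_pow, Real.sq_sqrt hK'.le]
    field_simp
  have hpre : Real.sqrt (K / (2 * Real.pi)) / (Real.sqrt K * ρ⁻¹) =
      ρ / Real.sqrt (2 * Real.pi) := by
    have := Real.pi_pos
    have := Real.sqrt_pos.2 hK'
    rw [Real.sqrt_div hK'.le]
    field_simp
  have hB := blockTrace_le hK rfl (by linarith) (Real.rpow_pos_of_pos (by linarith) _)
    (by linarith) (by nlinarith) hex (ε := windowWidth (Real.sqrt K * ρ⁻¹))
  have hpar := (abs_le.1 (abs_two_mul_paritySum_sub_le K (Real.sqrt K * ρ⁻¹))).2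
  rw [hpre] at hB
  refine hB.trans ?_
  clear hB
  rw [invEigenvalueAsymp, upperError]
  set x := Real.sqrt K * ρ⁻¹
  set ε := windowWidth x
  have hx0 : 0 < x := by linarith
  have hE := besselAsymp_pos hx0
  have hexp : Real.exp (-((1 - ε) * x * ((1 - ε) * x - 1)) / (2 * K)) =
      Real.exp (-((1 - ε) ^ 2 / (2 * ρ ^ 2)) + (1 - ε) / (2 * ρ ^ 2) * x⁻¹ + 1 / (2 * ρ ^ 2)) *
        Real.exp (-(1 / (2 * ρ ^ 2))) := by
    rw [← Real.exp_add, ← hxsq]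
    congr 1
    field_simp
    ring
  rw [hexp]
  set Q := Real.exp (-((1 - ε) ^ 2 / (2 * ρ ^ 2)) + (1 - ε) / (2 * ρ ^ 2) * x⁻¹ + 1 / (2 * ρ ^ 2))
  have hQ : 0 < Q := Real.exp_pos _
  have hneg : Real.exp (1 / (2 * ρ ^ 2)) = (Real.exp (-(1 / (2 * ρ ^ 2))))⁻¹ := by
    rw [← Real.exp_neg, neg_neg]
  rw [hneg]
  set S := Real.exp (-(1 / (2 * ρ ^ 2)))
  have hS : 0 < S := Real.exp_pos _
  have h1ε : 0 < 1 - ε := by linarith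
  have hspi : 0 < Real.sqrt (2 * Real.pi) := by have := Real.pi_pos; positivity
  have hεpos : 0 < ε := Real.rpow_pos_of_pos hx0 _
  calc _ ≤ ρ / Real.sqrt (2 * Real.pi) * (Q * S / (1 - ε) * ((besselSum x + 1) / 2) +
        2 * ((2 * x + 1) / (x ^ 2 * (ε / 2) ^ 2) * besselSum x)) := by
        gcongr
        linarith
    _ = _ := by
        field_simp
        ring

/-- The relative error in the lower bound for the largest eigenvalue of the inverse matrix. -/
noncomputable def lowerError (ρ x : ℝ) : ℝ :=
  Real.sqrt (1 / (1 + ρ⁻¹ ^ 2 * x⁻¹ ^ 2)) *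
    Real.exp (-((1 + windowWidth x) ^ 2 / (2 * ρ ^ 2)) - (1 + windowWidth x) ^ 3 / ρ ^ 4 * x⁻¹ +
      1 / (2 * ρ ^ 2)) *
    (besselSum x / besselAsymp x - (besselAsymp x)⁻¹ -
      2 * ((2 * x + 1) / (x ^ 2 * windowWidth x ^ 2)) * (besselSum x / besselAsymp x)) *
    (1 - Real.exp (-(2 * (windowWidth x * x)))) * ((1 - 2 * windowWidth x) / (1 + windowWidth x))

theorem tendsto_lowerError (ρ : ℝ) : Tendsto (lowerError ρ) atTop (𝓝 1) := by
  have hi : Tendsto (fun x : ℝ => x⁻¹) atTop (𝓝 0) := tendsto_inv_atTop_zero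
  have h1 := tendsto_windowWidth.const_add 1
  have h2 := ((((h1.pow 2).div_const (2 * ρ ^ 2)).neg.sub (((h1.pow 3).div_const (ρ ^ 4)).mul
    hi)).add_const (1 / (2 * ρ ^ 2))).rexp
  have h3 := ((tendsto_const_nhds (x := (1 : ℝ))).div
    (((hi.pow 2).const_mul (ρ⁻¹ ^ 2)).const_add 1) (by norm_num)).sqrt
  have h4 := (tendsto_besselSum_div.sub tendsto_inv_besselAsymp).sub
    ((tendsto_tail.const_mul 2).mul tendsto_besselSum_div)
  have h5 := (Real.tendsto_exp_neg_atTop_nhds_zero.comp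
    (tendsto_windowWidth_mul.const_mul_atTop two_pos)).const_sub 1
  have h6 := ((tendsto_windowWidth.const_mul 2).const_sub 1).div h1 (by norm_num)
  have h7 := (((h3.mul h2).mul h4).mul h5).mul h6
  refine h7.trans (le_of_eq ?_)
  congr 1
  simp

theorem eventually_momentEigenvalueMin_mul_le_one {Ω : Type*} [MeasurableSpace Ω] {P : Measure Ω}
    {w : Ω → ℝ} {ρ : ℝ} (hρ : 0 < ρ)
    (hw : HasLaw w (gaussianReal 0 (Real.toNNReal (ρ ^ 2))) P) :
    ∀ᶠ T : ℕ in atTop, momentEigenvalueMin P w T *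
      (lowerError ρ (Real.sqrt T * ρ⁻¹) * invEigenvalueAsymp ρ T) ≤ 1 := by
  have hx := tendsto_sqrt_mul_inv_atTop hρ
  have hε := (tendsto_windowWidth.comp hx).eventually (gt_mem_nhds (by norm_num : (0 : ℝ) < 1 / 8))
  have hεx := (tendsto_windowWidth_mul.comp hx).eventually_ge_atTop 1
  filter_upwards [hx.eventually_ge_atTop (8 / ρ ^ 2), hx.eventually_gt_atTop 0, hε, hεx,
    eventually_gt_atTop 0] with T hx8 hx0 he hex hT
  simp only [Function.comp] at he hex
  have hT' : (0 : ℝ) < T := by exact_mod_cast hT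
  have hxsq : (Real.sqrt T * ρ⁻¹) ^ 2 * ρ ^ 2 = T := by
    rw [mul_pow, Real.sq_sqrt hT'.le]
    field_simp
  have hsT : Real.sqrt T = ρ * (Real.sqrt T * ρ⁻¹) := by field_simp
  have hpar := (abs_le.1 (abs_two_mul_paritySum_sub_le T (Real.sqrt T * ρ⁻¹))).1
  rw [invEigenvalueAsymp, lowerError]
  have hxT : 8 * (Real.sqrt T * ρ⁻¹) ≤ T := by
    rw [div_le_iff₀ (by positivity)] at hx8
    calc 8 * (Real.sqrt T * ρ⁻¹) ≤ Real.sqrt T * ρ⁻¹ * ρ ^ 2 * (Real.sqrt T * ρ⁻¹) := by gcongr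
      _ = (Real.sqrt T * ρ⁻¹) ^ 2 * ρ ^ 2 := by ring
      _ = T := hxsq
  generalize hX : Real.sqrt T * ρ⁻¹ = x at *
  set ε := windowWidth x
  have hεpos : 0 < ε := Real.rpow_pos_of_pos hx0 _
  set J := ⌊(1 + ε) * x⌋₊
  set I := ⌊ε * T⌋₊
  have hJ1 : (J : ℝ) ≤ (1 + ε) * x := Nat.floor_le (by positivity)
  have hJ2 : (1 + ε) * x < J + 1 := Nat.lt_floor_add_one _
  have hI1 : (I : ℝ) ≤ ε * T := Nat.floor_le (by positivity)
  have hI2 : ε * T < I + 1 := Nat.lt_floor_add_one _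
  -- From `ε < 1/8` and `8 x ≤ T`; these two bounds keep `J + 2 I` below `T`.
  have hJ4 : (J : ℝ) ≤ T / 4 := by nlinarith
  have hI8 : (I : ℝ) ≤ T / 8 := by nlinarith
  have hJI : J + 2 * I < T := by
    have : (J : ℝ) + 2 * I < T := by linarith
    exact_mod_cast this
  have hJT : 2 * J ≤ T := by
    have : (2 : ℝ) * J ≤ T := by linarith
    exact_mod_cast this
  have hxJ : x ≤ J := by linarith
  have hA := le_sum_sq_orthoCoeff hT hX.symm hx0 hεpos hJ1 hJ2 hJT
  have hG := le_sum_geom hx0 hεpos hxJ hJ1 hI1 hI2 hJI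
  have hmain := momentEigenvalueMin_mul_le_one hρ hw hJI
  have hl := momentEigenvalueMin_pos T hρ hw
  refine le_trans (mul_le_mul_of_nonneg_left ?_ hl.le) hmain
  have hA0 : 0 ≤ ∑ j ∈ Finset.range (J + 1) with Even (T + j), orthoCoeff ρ T j ^ 2 :=
    Finset.sum_nonneg fun _ _ => sq_nonneg _
  have hexp1 : Real.exp (-(2 * ε * x)) ≤ 1 := by
    rw [Real.exp_le_one_iff, neg_nonpos]
    positivity
  have hG0 : 0 ≤ (1 - Real.exp (-(2 * ε * x))) * (T * (1 - 2 * ε) / (2 * ((1 + ε) * x))) := by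
    have : 0 ≤ 1 - 2 * ε := by linarith
    have : 0 ≤ 1 - Real.exp (-(2 * ε * x)) := by linarith
    positivity
  refine le_trans ?_ (mul_le_mul hA hG hG0 hA0)
  have hE := besselAsymp_pos hx0
  have hpi := Real.pi_pos
  have hexp : Real.exp (-((1 + ε) * x) ^ 2 / (2 * T) - ((1 + ε) * x) ^ 3 / T ^ 2) =
      Real.exp (-((1 + ε) ^ 2 / (2 * ρ ^ 2)) - (1 + ε) ^ 3 / ρ ^ 4 * x⁻¹ + 1 / (2 * ρ ^ 2)) *
        Real.exp (-(1 / (2 * ρ ^ 2))) := by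
    rw [← Real.exp_add, ← hxsq]
    congr 1
    field_simp
    ring
  rw [hexp, show 2 * (ε * x) = 2 * ε * x by ring]
  set Q := Real.exp (-((1 + ε) ^ 2 / (2 * ρ ^ 2)) - (1 + ε) ^ 3 / ρ ^ 4 * x⁻¹ + 1 / (2 * ρ ^ 2))
  set S := Real.exp (-(1 / (2 * ρ ^ 2)))
  set F := 1 - Real.exp (-(2 * ε * x))
  have hQ : 0 < Q := Real.exp_pos _
  have hS : 0 < S := Real.exp_pos _
  have hF : 0 ≤ F := by linarith
  have hsq : Real.sqrt (2 / (Real.pi * (T + 1))) * T =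
      Real.sqrt (1 / (1 + ρ⁻¹ ^ 2 * x⁻¹ ^ 2)) * (2 * (ρ * x) / Real.sqrt (2 * Real.pi)) := by
    have h1 : (2 : ℝ) / (Real.pi * (T + 1)) =
        1 / (1 + ρ⁻¹ ^ 2 * x⁻¹ ^ 2) * (2 ^ 2 / (2 * Real.pi) / T) := by
      rw [← hxsq]
      field_simp
    have h3 : Real.sqrt (2 ^ 2 / (2 * Real.pi) / T) =
        2 / Real.sqrt (2 * Real.pi) / (ρ * x) := by
      rw [Real.sqrt_div (by positivity), Real.sqrt_div (by positivity), Real.sqrt_sq two_pos.le,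
        hsT]
    rw [h1, Real.sqrt_mul (by positivity), h3]
    have h2 : (T : ℝ) = (ρ * x) * (ρ * x) := by rw [← hxsq]; ring
    rw [h2]
    have : 0 < Real.sqrt (2 * Real.pi) := by positivity
    field_simp
  set B := Real.sqrt (1 / (1 + ρ⁻¹ ^ 2 * x⁻¹ ^ 2))
  have hB : 0 ≤ B := Real.sqrt_nonneg _
  have hspi : 0 < Real.sqrt (2 * Real.pi) := by positivity
  have h1ε : 0 ≤ 1 - 2 * ε := by linarith
  set tail := (2 * x + 1) / (x ^ 2 * ε ^ 2)
  calc _ = (B * (2 * (ρ * x) / Real.sqrt (2 * Real.pi))) * (Q * S * F * ((1 - 2 * ε) /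
        (2 * ((1 + ε) * x)))) * ((besselSum x - 1) / 2 - tail * besselSum x) := by
        field_simp
    _ ≤ (B * (2 * (ρ * x) / Real.sqrt (2 * Real.pi))) * (Q * S * F * ((1 - 2 * ε) /
        (2 * ((1 + ε) * x)))) * (paritySum T x - tail * besselSum x) := by
        refine mul_le_mul_of_nonneg_left (by linarith) (by positivity)
    _ = _ := by
        rw [← hsq]
        ring

theorem asympEquiv_momentEigenvalueMin {Ω : Type*} [MeasurableSpace Ω] {P : Measure Ω}
    {w : Ω → ℝ} {ρ : ℝ} (hρ : 0 < ρ)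
    (hw : HasLaw w (gaussianReal 0 (Real.toNNReal (ρ ^ 2))) P) :
    AsympEquiv (fun T => momentEigenvalueMin P w T)
      (fun T => (2 : ℝ) ^ (5 / 2 : ℝ) * Real.pi * (T : ℝ) ^ (1 / 4 : ℝ) / ρ ^ (3 / 2 : ℝ) *
        Real.exp (1 / (2 * ρ ^ 2) - 2 * Real.sqrt (T : ℝ) / ρ)) := by
  have hx := tendsto_sqrt_mul_inv_atTop hρ
  have hL : Tendsto (fun T : ℕ => (lowerError ρ (Real.sqrt T * ρ⁻¹))⁻¹) atTop (𝓝 1) := by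
    simpa using ((tendsto_lowerError ρ).comp hx).inv₀ one_ne_zero
  have hU : Tendsto (fun T : ℕ => upperError ρ (Real.sqrt T * ρ⁻¹)) atTop (𝓝 1) :=
    (tendsto_upperError ρ).comp hx
  have hS := tendsto_invEigenvalueAsymp_succ_div hρ
  have hU1 : Tendsto (fun T : ℕ => upperError ρ (Real.sqrt (T + 1 : ℕ) * ρ⁻¹) *
      (invEigenvalueAsymp ρ (T + 1) / invEigenvalueAsymp ρ T)) atTop (𝓝 1) := by
    simpa using (hU.comp (tendsto_add_atTop_nat 1)).mul hS
  have hU2 : Tendsto (fun T : ℕ => upperError ρ (Real.sqrt (T + 2 : ℕ) * ρ⁻¹) *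
      (invEigenvalueAsymp ρ (T + 2) / invEigenvalueAsymp ρ (T + 1) *
        (invEigenvalueAsymp ρ (T + 1) / invEigenvalueAsymp ρ T))) atTop (𝓝 1) := by
    have := (hU.comp (tendsto_add_atTop_nat 2)).mul ((hS.comp (tendsto_add_atTop_nat 1)).mul hS)
    simp only [mul_one] at this
    exact this
  -- Both parity blocks must be dominated, so the larger relative error is used.
  have hM := (hU1.max hU2).inv₀ (by simp)
  rw [max_self, inv_one] at hM
  have hB := eventually_blockTrace_le hρ
  have hdiv : ∀ (T : ℕ) (r : ℝ), 0 < T → r / ((2 : ℝ) ^ (5 / 2 : ℝ) * Real.pi *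
      (T : ℝ) ^ (1 / 4 : ℝ) / ρ ^ (3 / 2 : ℝ) *
        Real.exp (1 / (2 * ρ ^ 2) - 2 * Real.sqrt (T : ℝ) / ρ)) = r * invEigenvalueAsymp ρ T :=
    fun T r hT => by
      rw [div_eq_mul_inv, ← eq_inv_of_mul_eq_one_left (invEigenvalueAsymp_mul_eq_one hρ hT)]
  refine tendsto_of_tendsto_of_tendsto_of_le_of_le' hM hL ?_ ?_
  · filter_upwards [eventually_gt_atTop 0, (tendsto_add_atTop_nat 1).eventually hB,
      (tendsto_add_atTop_nat 2).eventually hB, (hU1.max hU2).eventually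
        (lt_mem_nhds (by simp : (0 : ℝ) < max 1 1))] with T hT h1 h2 h3
    have hp := invEigenvalueAsymp_pos hρ hT
    have hp1 := invEigenvalueAsymp_pos hρ (Nat.succ_pos T)
    rw [hdiv T _ hT]
    set m := max (upperError ρ (Real.sqrt (T + 1 : ℕ) * ρ⁻¹) *
      (invEigenvalueAsymp ρ (T + 1) / invEigenvalueAsymp ρ T))
      (upperError ρ (Real.sqrt (T + 2 : ℕ) * ρ⁻¹) *
      (invEigenvalueAsymp ρ (T + 2) / invEigenvalueAsymp ρ (T + 1) *
        (invEigenvalueAsymp ρ (T + 1) / invEigenvalueAsymp ρ T))) with hm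
    have hb : ∀ r s : ℝ, r / invEigenvalueAsymp ρ T ≤ m → s ≤ r →
        s ≤ m * invEigenvalueAsymp ρ T :=
      fun r s h h' => h'.trans ((div_le_iff₀ hp).1 h)
    have := inv_le_momentEigenvalueMin_of_blockTrace_le hρ hw (mul_pos h3 hp)
      (hb _ _ (by rw [mul_div_assoc]; exact le_max_left _ _) h1)
      (hb _ _ (by
        rw [mul_div_assoc]
        refine le_of_eq_of_le ?_ (le_max_right _ _)
        rw [div_mul_div_cancel₀ hp1.ne']) h2)
    rw [mul_inv] at this
    calc m⁻¹ = m⁻¹ * (invEigenvalueAsymp ρ T)⁻¹ * invEigenvalueAsymp ρ T := by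
          field_simp
      _ ≤ _ := by gcongr
  · filter_upwards [eventually_gt_atTop 0, eventually_momentEigenvalueMin_mul_le_one hρ hw,
      ((tendsto_lowerError ρ).comp hx).eventually (lt_mem_nhds one_pos)] with T hT h1 h2
    change 0 < lowerError ρ (Real.sqrt T * ρ⁻¹) at h2
    rw [hdiv T _ hT, ← one_div, le_div_iff₀ h2]
    linarith

end SmallestEigenvalueAsymptotics

/-! ### Largest eigenvalue and trace -/

section LargestEigenvalue

open Filter Topology

theorem stdMoment_two_mul (n : ℕ) :
    stdMoment (2 * n) = (2 * n).factorial / (2 ^ n * n.factorial) := by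
  induction n with
  | zero => simp [stdMoment]
  | succ n ih =>
    rw [show 2 * (n + 1) = 2 * n + 2 by ring, stdMoment, ih, Nat.factorial_succ (2 * n + 1),
      Nat.factorial_succ (2 * n), Nat.factorial_succ n]
    push_cast
    field_simp
    ring

/-- The even moments of the centred Gaussian distribution with standard deviation `ρ`. -/
noncomputable def evenMoment (ρ : ℝ) (n : ℕ) : ℝ := ρ ^ (2 * n) * stdMoment (2 * n)

theorem evenMoment_pos {ρ : ℝ} (hρ : 0 < ρ) (n : ℕ) : 0 < evenMoment ρ n := by
  rw [evenMoment, stdMoment_two_mul]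
  positivity

theorem evenMoment_succ (ρ : ℝ) (n : ℕ) :
    evenMoment ρ (n + 1) = ρ ^ 2 * (2 * n + 1) * evenMoment ρ n := by
  rw [evenMoment, evenMoment, show 2 * (n + 1) = 2 * n + 2 by ring, stdMoment]
  push_cast
  ring

/-- The ratio satisfies `S (T + 1) = 1 + S T / (ρ² (2T + 1))`; it is bounded, so the recursion
forces the limit 1. -/
theorem tendsto_sum_evenMoment_div {ρ : ℝ} (hρ : 0 < ρ) :
    Tendsto (fun T => (∑ i ∈ Finset.range (T + 1), evenMoment ρ i) / evenMoment ρ T)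
      atTop (𝓝 1) := by
  set S : ℕ → ℝ := fun T => (∑ i ∈ Finset.range (T + 1), evenMoment ρ i) / evenMoment ρ T with hS
  have hrec : ∀ T, S (T + 1) = S T / (ρ ^ 2 * (2 * T + 1)) + 1 := by
    intro T
    simp only [hS]
    have := evenMoment_pos hρ T
    rw [Finset.sum_range_succ, evenMoment_succ]
    field_simp
  have hpos : ∀ T, 0 ≤ S T := fun T =>
    div_nonneg (Finset.sum_nonneg fun i _ => (evenMoment_pos hρ i).le) (evenMoment_pos hρ T).le
  have hlin : Tendsto (fun T : ℕ => ρ ^ 2 * (2 * (T : ℝ) + 1)) atTop atTop :=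
    (tendsto_atTop_add_const_right _ 1
      (tendsto_natCast_atTop_atTop.const_mul_atTop two_pos)).const_mul_atTop (by positivity)
  obtain ⟨N, hN⟩ := eventually_atTop.1 (hlin.eventually_ge_atTop 2)
  -- Past `N` the divisor is at least 2, and `s ↦ s / 2 + 1` preserves the bound `S N + 2`.
  have hbdd : ∀ T, N ≤ T → S T ≤ S N + 2 := by
    intro T hT
    induction T, hT using Nat.le_induction with
    | base => linarith
    | succ T hT ih =>
      rw [hrec]
      have h1 : S T / (ρ ^ 2 * (2 * T + 1)) ≤ (S N + 2) / 2 := by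
        have := hN T hT
        have := hpos N
        gcongr
      have := hpos N
      linarith
  rw [← tendsto_add_atTop_iff_nat 1]
  have h0 : Tendsto (fun T : ℕ => (S N + 2) / (ρ ^ 2 * (2 * (T : ℝ) + 1)) + 1) atTop (𝓝 1) := by
    simpa using (hlin.const_div_atTop (S N + 2)).add_const 1
  refine tendsto_of_tendsto_of_tendsto_of_le_of_le' tendsto_const_nhds h0 ?_ ?_
  · refine Eventually.of_forall fun T => ?_
    change 1 ≤ S (T + 1)
    rw [hrec]
    have := hpos T
    have : 0 ≤ S T / (ρ ^ 2 * (2 * T + 1)) := by positivity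
    linarith
  · filter_upwards [eventually_ge_atTop N] with T hT
    change S (T + 1) ≤ _
    rw [hrec]
    have := hbdd T hT
    gcongr

/-- The quotient equals that of the Stirling sequences at `2T` and `T`, so `√π` cancels; `√2` comes
from `√(4T) / √(2T)`. -/
theorem tendsto_evenMoment_div (ρ : ℝ) (hρ : 0 < ρ) :
    Tendsto (fun T : ℕ => evenMoment ρ T /
      (Real.sqrt 2 * (2 * ρ ^ 2 * (T : ℝ) / Real.exp 1) ^ T)) atTop (𝓝 1) := by
  have hpi := Real.pi_pos
  have hs : Real.sqrt Real.pi ≠ 0 := by positivity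
  have h1 := Stirling.tendsto_stirlingSeq_sqrt_pi
  have h2 := (h1.comp (tendsto_id.const_mul_atTop' (two_pos : (0 : ℕ) < 2))).div h1 hs
  rw [div_self hs] at h2
  refine h2.congr' ?_
  filter_upwards [eventually_gt_atTop 0] with T hT
  have hT' : (0 : ℝ) < T := by exact_mod_cast hT
  simp only [Function.comp, id, Pi.div_apply, Stirling.stirlingSeq]
  rw [evenMoment, stdMoment_two_mul]
  push_cast
  rw [Real.sqrt_mul two_pos.le (2 * (T : ℝ))]
  have e := Real.exp_pos 1
  have : (2 * ρ ^ 2 * (T : ℝ) / Real.exp 1) ^ T =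
    2 ^ T * ρ ^ (2 * T) * ((T : ℝ) / Real.exp 1) ^ T := by
    rw [pow_mul, ← mul_pow, ← mul_pow]
    congr 1
    ring
  rw [this]
  have h3 : (2 * (T : ℝ) / Real.exp 1) ^ (2 * T) =
      2 ^ T * 2 ^ T * (((T : ℝ) / Real.exp 1) ^ T * ((T : ℝ) / Real.exp 1) ^ T) := by
    rw [mul_comm 2 T, pow_mul, sq, ← mul_pow, ← mul_pow, ← mul_pow, ← mul_pow]
    ring
  rw [mul_comm 2 T] at *
  rw [h3]
  have : 0 < Real.sqrt (2 * (T : ℝ)) := by positivity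
  have : 0 < ((T : ℝ) / Real.exp 1) ^ T := by positivity
  field_simp

variable {Ω : Type*} [MeasurableSpace Ω] {P : Measure Ω} {w : Ω → ℝ} {ρ : ℝ}

theorem evenMoment_le_momentEigenvalueMax (hρ : 0 < ρ)
    (hw : HasLaw w (gaussianReal 0 (Real.toNNReal (ρ ^ 2))) P) (T : ℕ) :
    evenMoment ρ T ≤ momentEigenvalueMax P w T := by
  have h := momentMatrix_last_le_momentEigenvalueMax P w T
  rw [momentMatrix_apply_of_gaussian hρ hw] at h
  simpa [evenMoment, two_mul] using h

theorem sum_momentEigenvalue_eq (hρ : 0 < ρ)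
    (hw : HasLaw w (gaussianReal 0 (Real.toNNReal (ρ ^ 2))) P) (T : ℕ) :
    ∑ i : Fin (T + 1), momentEigenvalue P w T i =
      ∑ i ∈ Finset.range (T + 1), evenMoment ρ i := by
  rw [sum_momentEigenvalue, Matrix.trace, Finset.sum_range]
  refine Finset.sum_congr rfl fun i _ => ?_
  rw [Matrix.diag_apply, momentMatrix_apply_of_gaussian hρ hw, evenMoment, two_mul]

theorem momentEigenvalueMax_le_sum_evenMoment (hρ : 0 < ρ)
    (hw : HasLaw w (gaussianReal 0 (Real.toNNReal (ρ ^ 2))) P) (T : ℕ) :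
    momentEigenvalueMax P w T ≤ ∑ i ∈ Finset.range (T + 1), evenMoment ρ i := by
  rw [← sum_momentEigenvalue_eq hρ hw]
  exact momentEigenvalueMax_le_sum P w T (momentEigenvalueMin_pos T hρ hw).le

theorem tendsto_momentEigenvalueMax_div_evenMoment (hρ : 0 < ρ)
    (hw : HasLaw w (gaussianReal 0 (Real.toNNReal (ρ ^ 2))) P) :
    Tendsto (fun T => momentEigenvalueMax P w T / evenMoment ρ T) atTop (𝓝 1) := by
  refine tendsto_of_tendsto_of_tendsto_of_le_of_le tendsto_const_nhds
    (tendsto_sum_evenMoment_div hρ) (fun T => ?_) (fun T => ?_)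
  · change 1 ≤ _
    rw [one_le_div (evenMoment_pos hρ T)]
    exact evenMoment_le_momentEigenvalueMax hρ hw T
  · exact div_le_div_of_nonneg_right (momentEigenvalueMax_le_sum_evenMoment hρ hw T)
      (evenMoment_pos hρ T).le

end LargestEigenvalue

theorem mainTheorem6 {Ω : Type*} [MeasurableSpace Ω] (P : Measure Ω) (w : Ω → ℝ)
    (ρ : ℝ) (hρ : 0 < ρ) (hw : HasLaw w (gaussianReal 0 (Real.toNNReal (ρ ^ 2))) P) :
    Filter.Tendsto
        (fun T : ℕ => momentEigenvalueMax P w T / ∑ i : Fin (T + 1), momentEigenvalue P w T i)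
        Filter.atTop (nhds 1) ∧
      AsympEquiv (fun T => momentEigenvalueMax P w T)
        (fun T => Real.sqrt 2 * (2 * ρ ^ 2 * (T : ℝ) / Real.exp 1) ^ T) ∧
      AsympEquiv (fun T => momentEigenvalueMin P w T)
        (fun T => (2 : ℝ) ^ (5 / 2 : ℝ) * Real.pi * (T : ℝ) ^ (1 / 4 : ℝ) / ρ ^ (3 / 2 : ℝ) *
          Real.exp (1 / (2 * ρ ^ 2) - 2 * Real.sqrt (T : ℝ) / ρ)) := by
  have hmax := tendsto_momentEigenvalueMax_div_evenMoment hρ hw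
  refine ⟨?_, ?_, asympEquiv_momentEigenvalueMin hρ hw⟩
  · have h := hmax.div (tendsto_sum_evenMoment_div hρ) one_ne_zero
    rw [div_one] at h
    refine h.congr fun T => ?_
    rw [Pi.div_apply, div_div_div_cancel_right₀ (evenMoment_pos hρ T).ne',
      sum_momentEigenvalue_eq hρ hw]
  · have h := hmax.mul (tendsto_evenMoment_div ρ hρ)
    rw [mul_one] at h
    refine h.congr fun T => ?_
    rw [div_mul_div_cancel₀ (evenMoment_pos hρ T).ne']
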